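/- For a real $n\times m$ matrix $A$ with nonzero rows $a_1,\dots,a_n$ let $\theta(A)=\sup_{x\in\mathbb R^m\setminus\{0\}}\min_{1\le i\le n}\arccos\frac{a_i\cdot x}{\|a_i\|\,\|x\|}$ and let $\mathscr C(A)=|\cos\theta(A)|^{-1}\in[1,\infty]$ be the condition number of the linear conic system $Ax\le 0$, $x\ne 0$ (with $\mathscr C(A)=\infty$ and $\log\mathscr C(A)=\infty$ if $\theta(A)=\pi/2$). For $m\ge 3$ put $I_{m-2}(\rho)=\int_0^\rho\sin^{m-2}x\,dx$ and $\varphi(t)=1-\dfrac{I_{m-2}(\arccos e^{-t})}{I_{m-2}(\pi)}$ for $t\ge 0$; this is a strictly decreasing bijection from $[0,\infty)$ onto $(\tfrac12,1]$. Let $f(m,n)=\varphi^{-1}\bigl((1/2)^{1/\sqrt n}\bigr)$. Let $n\ge m\ge 3$ and let $A$ be a uniform random $n\times m$ matrix, that is, its rows $A_1,\dots,A_n$ are independent random vectors, each uniformly distributed on the unit sphere $S^{m-1}\subset\mathbb R^m$. Then $\mathscr C(A)$ is a $[1,\infty]$-valued random variable, and for all real $\gamma\ge 0$ $$\mathbf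 E\bigl[(\log\mathscr C(A))^\gamma\bigr]\;\le\; f(m,n)^\gamma+\binom nm\,2\,m^{5/2}\,2^{-\frac{n-m}{\sqrt n}}\,\Gamma(\gamma+1).$$ -/

import Mathlib

open MeasureTheory ProbabilityTheory Set
open scoped ENNReal

noncomputable section

namespace ConicCond

/-- The `i`-th row of a real `n × m` matrix, as a vector of Euclidean space. -/
def row {n m : ℕ} (A : Matrix (Fin n) (Fin m) ℝ) (i : Fin n) : EuclideanSpace ℝ (Fin m) :=
  WithLp.toLp 2 (A i)

/-- `θ(A, x) = min_i θ_i(A, x)`, where `θ_i(A, x) ∈ [0, π]` is the angle between the `i`-th row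
of `A` and `x`. -/
def thetaAt {n m : ℕ} (A : Matrix (Fin n) (Fin m) ℝ) (x : EuclideanSpace ℝ (Fin m)) : ℝ :=
  ⨅ i : Fin n, InnerProductGeometry.angle (row A i) x

/-- `θ(A) = sup_{x ≠ 0} θ(A, x)`. -/
def theta {n m : ℕ} (A : Matrix (Fin n) (Fin m) ℝ) : ℝ :=
  ⨆ x : {x : EuclideanSpace ℝ (Fin m) // x ≠ 0}, thetaAt A x

/-- The condition number `𝒞(A) = 1 / |cos θ(A)|`, with the value `∞` if `cos θ(A) = 0`. -/
def condNumber {n m : ℕ} (A : Matrix (Fin n) (Fin m) ℝ) : ℝ≥0∞ :=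
  (ENNReal.ofReal |Real.cos (theta A)|)⁻¹

/-- `log 𝒞(A)` as an element of `[0, ∞]`. Here `ENNReal.log` takes its values in the extended
reals, with `log ∞ = ∞`; since `𝒞(A) ≥ 1`, the conversion to `[0, ∞]` loses nothing. -/
def logCondNumber {n m : ℕ} (A : Matrix (Fin n) (Fin m) ℝ) : ℝ≥0∞ :=
  (ENNReal.log (condNumber A)).toENNReal

/-- The unit sphere of `ℝ^m`. -/
abbrev USphere (m : ℕ) : Type := Metric.sphere (0 : EuclideanSpace ℝ (Fin m)) 1

/-- The uniform probability measure on the unit sphere: normalised surface measure. -/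
def uniformSphere (m : ℕ) : Measure (USphere m) :=
  ((volume : Measure (EuclideanSpace ℝ (Fin m))).toSphere univ)⁻¹ •
    (volume : Measure (EuclideanSpace ℝ (Fin m))).toSphere

/-- The matrix with the given unit rows. -/
def matrixOfRows {n m : ℕ} (a : Fin n → USphere m) : Matrix (Fin n) (Fin m) ℝ :=
  Matrix.of fun i j => (a i : EuclideanSpace ℝ (Fin m)) j

/-- `A₁, …, Aₙ` are i.i.d. random vectors, uniformly distributed on the unit sphere. -/
structure IsUniformRandomRows {Ω : Type*} [MeasurableSpace Ω] (P : Measure Ω) {n m : ℕ}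
    (A : Fin n → Ω → USphere m) : Prop where
  measurable : ∀ i, Measurable (A i)
  indep : iIndepFun A P
  law : ∀ i, P.map (A i) = uniformSphere m

/-- `I_k(ρ) = ∫_0^ρ sin^k x dx`. -/
def sinInt (k : ℕ) (ρ : ℝ) : ℝ := ∫ x in (0 : ℝ)..ρ, Real.sin x ^ k

/-- `φ(t) = 1 - I_{m-2}(arccos e^{-t}) / I_{m-2}(π)`. Meant for `t ≥ 0` and `m ≥ 2`. -/
def phi (m : ℕ) (t : ℝ) : ℝ :=
  1 - sinInt (m - 2) (Real.arccos (Real.exp (-t))) / sinInt (m - 2) Real.pi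

/-- `f(m, n) = φ⁻¹((1/2)^{1/√n})`, where `φ⁻¹` is the inverse of the bijection
`φ : [0, ∞) → (1/2, 1]`, see `phi_bijOn`. -/
def cutoff (m n : ℕ) : ℝ :=
  Function.invFunOn (phi m) (Ici 0) ((1 / 2 : ℝ) ^ (1 / Real.sqrt n))

/-! Proof that `φ` is a bijection from `[0, ∞)` to `(1/2, 1]`. -/

lemma sinInt_continuous (k : ℕ) : Continuous (sinInt k) :=
  intervalIntegral.continuous_primitive
    (fun a b => (Real.continuous_sin.pow k).intervalIntegrable a b) 0

lemma sinInt_lt (k : ℕ) {a b : ℝ} (ha : 0 ≤ a) (hab : a < b) (hb : b ≤ Real.pi) :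
    sinInt k a < sinInt k b := by
  have hi : ∀ u v : ℝ, IntervalIntegrable (fun x => Real.sin x ^ k) volume u v :=
    fun u v => (Real.continuous_sin.pow k).intervalIntegrable u v
  have h := intervalIntegral.integral_add_adjacent_intervals (hi 0 a) (hi a b)
  have hpos : 0 < ∫ x in a..b, Real.sin x ^ k := by
    apply intervalIntegral.intervalIntegral_pos_of_pos_on (hi a b) _ hab
    intro x hx
    exact pow_pos (Real.sin_pos_of_pos_of_lt_pi (ha.trans_lt hx.1) (hx.2.trans_le hb)) k
  unfold sinInt
  linarith

lemma sinInt_zero (k : ℕ) : sinInt k 0 = 0 := by simp [sinInt]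

lemma sinInt_pi_pos (k : ℕ) : 0 < sinInt k Real.pi := by
  have := sinInt_lt k le_rfl Real.pi_pos le_rfl
  rwa [sinInt_zero] at this

lemma sinInt_pi (k : ℕ) : sinInt k Real.pi = 2 * sinInt k (Real.pi / 2) := by
  have hi : ∀ u v : ℝ, IntervalIntegrable (fun x => Real.sin x ^ k) volume u v :=
    fun u v => (Real.continuous_sin.pow k).intervalIntegrable u v
  have h := intervalIntegral.integral_add_adjacent_intervals
    (hi 0 (Real.pi / 2)) (hi (Real.pi / 2) Real.pi)
  have h2 : ∫ x in (Real.pi / 2)..Real.pi, Real.sin x ^ k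
      = ∫ x in (0 : ℝ)..(Real.pi / 2), Real.sin x ^ k := by
    have := intervalIntegral.integral_comp_sub_left (a := 0) (b := Real.pi / 2)
      (fun x => Real.sin x ^ k) Real.pi
    simp only [Real.sin_pi_sub, sub_zero] at this
    rw [this]
    congr 1
    ring
  unfold sinInt
  linarith

lemma arccos_exp_mem {t : ℝ} :
    0 ≤ Real.arccos (Real.exp (-t)) ∧ Real.arccos (Real.exp (-t)) < Real.pi / 2 :=
  ⟨Real.arccos_nonneg _, Real.arccos_lt_pi_div_two.2 (Real.exp_pos _)⟩

theorem phi_bijOn (m : ℕ) : BijOn (phi m) (Ici 0) (Ioc (1 / 2) 1) := by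
  have hpi := sinInt_pi_pos (m - 2)
  have h2 := sinInt_pi (m - 2)
  refine ⟨?_, ?_, ?_⟩
  · intro t _
    obtain ⟨h0, h1⟩ := arccos_exp_mem (t := t)
    have hlt := sinInt_lt (m - 2) h0 h1 (by linarith [Real.pi_pos])
    have hnn : 0 ≤ sinInt (m - 2) (Real.arccos (Real.exp (-t))) := by
      rcases h0.eq_or_lt with h | h
      · rw [← h, sinInt_zero]
      · have := sinInt_lt (m - 2) le_rfl h (by linarith [Real.pi_pos])
        rw [sinInt_zero] at this
        exact this.le
    constructor
    · have : sinInt (m - 2) (Real.arccos (Real.exp (-t))) / sinInt (m - 2) Real.pi < 1 / 2 := by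
        rw [div_lt_iff₀ hpi]; linarith
      unfold phi; linarith
    · have := div_nonneg hnn hpi.le
      unfold phi; linarith
  · have : StrictAntiOn (phi m) (Ici 0) := by
      intro s hs t ht hst
      have hs' : (0 : ℝ) ≤ s := hs
      have hc : Real.arccos (Real.exp (-s)) < Real.arccos (Real.exp (-t)) := by
        apply Real.strictAntiOn_arccos
        · exact ⟨by linarith [Real.exp_pos (-t)], Real.exp_le_one_iff.2 (by linarith)⟩
        · exact ⟨by linarith [Real.exp_pos (-s)], Real.exp_le_one_iff.2 (by linarith)⟩
        · exact Real.exp_lt_exp.2 (by linarith)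
      have := sinInt_lt (m - 2) (Real.arccos_nonneg _) hc (Real.arccos_le_pi _)
      have := div_lt_div_of_pos_right this hpi
      unfold phi
      linarith
    exact this.injOn
  · intro y hy
    have hmem : (1 - y) * sinInt (m - 2) Real.pi
        ∈ Icc (sinInt (m - 2) 0) (sinInt (m - 2) (Real.pi / 2)) := by
      rw [sinInt_zero]
      constructor
      · exact mul_nonneg (by linarith [hy.2]) hpi.le
      · nlinarith [hy.1]
    obtain ⟨ρ, hρ, hρy⟩ := intermediate_value_Icc (by linarith [Real.pi_pos])
      (sinInt_continuous (m - 2)).continuousOn hmem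
    have hne : ρ ≠ Real.pi / 2 := by
      rintro rfl
      nlinarith [hy.1]
    have hlt : ρ < Real.pi / 2 := lt_of_le_of_ne hρ.2 hne
    have hcos : 0 < Real.cos ρ :=
      Real.cos_pos_of_mem_Ioo ⟨by linarith [hρ.1, Real.pi_pos], hlt⟩
    refine ⟨-Real.log (Real.cos ρ), ?_, ?_⟩
    · have := Real.log_nonpos hcos.le (Real.cos_le_one ρ)
      simpa using this
    · unfold phi
      rw [neg_neg, Real.exp_log hcos, Real.arccos_cos hρ.1 (by linarith [Real.pi_pos]), hρy,
        mul_div_assoc, div_self hpi.ne']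
      ring

end ConicCond

end

noncomputable section

namespace ConicCond

/-! As arccos decreases, c = cos θ(A) is the minimum over unit vectors x of max_i ⟨x, a_i⟩
(`exists_cos_theta`), and the task is to bound the probability that |c| ≤ ε = e^{-t}. Almost surely
such a configuration has a set K of m rows whose convex hull has a least-norm point p with ‖p‖ ≤ ε,
and one sign σ = ±1 such that σ⟨p, a_j⟩ ≤ ‖p‖² for every row outside K (`exists_mem_minNormEvent`).
For c > 0 one takes p = c x₀ with x₀ the minimiser, and K among the rows active at x₀; for c ≤ 0, p
is the least-norm point of the hull of all rows.

Fix K and σ. The point p depends on the rows in K only, so given these, each of the other n - m rows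
has to avoid a fixed spherical cap, independently and with probability φ(t). Moreover the hull of
the rows in K comes ε-close to 0. Dividing by the largest weight puts some row within mε of the span
of the m - 1 others, hence in an equatorial band of measure at most mε√m; a union bound over the row
gives m^{5/2} ε. Thus P(|c| ≤ e^{-t}) ≤ 2 binom(n,m) φ(t)^{n-m} m^{5/2} e^{-t}
(`measure_abs_cos_theta_le`).

For t ≥ f(m,n) one has φ(t) ≤ 2^{-1/√n}, so log 𝒞(A) has a tail C e^{-t} beyond f. Integrating γ
t^{γ-1} against the tail, bounded by 1 up to f, yields f^γ + C Γ(γ+1)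
(`lintegral_rpow_le_of_exp_tail`). -/

/-! ### Law of the angle to a fixed direction under the uniform measure (dimension m = k + 2) -/

theorem lintegral_fun_norm_addHaar {E : Type*} [NormedAddCommGroup E] [NormedSpace ℝ E]
    [MeasurableSpace E] [Nontrivial E] (μ : Measure E) [FiniteDimensional ℝ E] [BorelSpace E]
    [μ.IsAddHaarMeasure] {f : ℝ → ℝ≥0∞} (hf : Measurable f) :
    ∫⁻ x, f ‖x‖ ∂μ = μ.toSphere univ *
      ∫⁻ r in Ioi (0 : ℝ), ENNReal.ofReal (r ^ (Module.finrank ℝ E - 1)) * f r := by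
  calc
    ∫⁻ x, f ‖x‖ ∂μ = ∫⁻ x : ({(0)}ᶜ : Set E), f (‖x.1‖) ∂(μ.comap (↑)) := by
      rw [lintegral_subtype_comap (measurableSet_singleton _).compl fun x ↦ f (‖x‖),
        restrict_compl_singleton]
    _ = ∫⁻ x, f x.2 ∂μ.toSphere.prod (.volumeIoiPow (Module.finrank ℝ E - 1)) := by
      rw [← μ.measurePreserving_homeomorphUnitSphereProd.lintegral_comp_emb
        (Homeomorph.measurableEmbedding _)]
      simp
    _ = μ.toSphere univ *
        ∫⁻ x : Ioi (0 : ℝ), f x ∂.volumeIoiPow (Module.finrank ℝ E - 1) := by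
      rw [lintegral_prod _ (by fun_prop)]
      simp [mul_comm]
    _ = _ := by
      congr 1
      rw [Measure.volumeIoiPow, lintegral_withDensity_eq_lintegral_mul _ (by fun_prop) (by fun_prop)]
      simp only [Pi.mul_apply]
      rw [lintegral_subtype_comap measurableSet_Ioi
        fun r : ℝ => ENNReal.ofReal (r ^ (Module.finrank ℝ E - 1)) * f r]

/-- Integration of a function of one coordinate and of the norm. -/
theorem lintegral_inner_norm (k : ℕ) {u : EuclideanSpace ℝ (Fin (k + 2))} (hu : ‖u‖ = 1)
    {g : ℝ → ℝ → ℝ≥0∞} (hg : Measurable (Function.uncurry g)) :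
    ∫⁻ x : EuclideanSpace ℝ (Fin (k + 2)), g (inner ℝ u x) ‖x‖ =
      (volume : Measure (EuclideanSpace ℝ (Fin (k + 1)))).toSphere univ *
        ∫⁻ y : ℝ, ∫⁻ r in Ioi (0 : ℝ), ENNReal.ofReal (r ^ k) * g y (Real.sqrt (y ^ 2 + r ^ 2)) := by
  -- Coordinates in an orthonormal basis starting with `u` preserve volume, so `u` may be taken to
  -- be the first coordinate vector.
  obtain ⟨b, hb⟩ : ∃ b : OrthonormalBasis (Fin (k + 2)) ℝ (EuclideanSpace ℝ (Fin (k + 2))),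
      b 0 = u := by
    have hv : Orthonormal ℝ (({0} : Set (Fin (k + 2))).domRestrict fun _ => u) := by
      constructor
      · intro i; exact hu
      · intro i j hij; exact absurd (Subsingleton.elim i j) hij
    obtain ⟨b, hb⟩ := hv.exists_orthonormalBasis_extension_of_card_eq (by simp)
    exact ⟨b, hb 0 rfl⟩
  have h1 : ∫⁻ x : EuclideanSpace ℝ (Fin (k + 2)), g (inner ℝ u x) ‖x‖ =
      ∫⁻ z : EuclideanSpace ℝ (Fin (k + 2)), g (z 0) ‖z‖ := by
    rw [← b.measurePreserving_repr.lintegral_comp_emb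
      b.repr.toHomeomorph.measurableEmbedding (fun z => g (z 0) ‖z‖)]
    simp [b.repr_apply_apply, hb]
  have h2 : ∫⁻ z : EuclideanSpace ℝ (Fin (k + 2)), g (z 0) ‖z‖ =
      ∫⁻ z : Fin (k + 2) → ℝ, g (z 0) ‖(WithLp.toLp 2 z : EuclideanSpace ℝ (Fin (k + 2)))‖ := by
    rw [← (PiLp.volume_preserving_toLp (Fin (k + 2))).lintegral_comp_emb
      (MeasurableEquiv.toLp 2 (Fin (k + 2) → ℝ)).measurableEmbedding]
  have h3 : ∫⁻ z : Fin (k + 2) → ℝ, g (z 0) ‖(WithLp.toLp 2 z : EuclideanSpace ℝ (Fin (k + 2)))‖ =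
      ∫⁻ p : ℝ × (Fin (k + 1) → ℝ),
        g p.1 (Real.sqrt (p.1 ^ 2 + ‖(WithLp.toLp 2 p.2 : EuclideanSpace ℝ (Fin (k + 1)))‖ ^ 2)) := by
    rw [← (volume_preserving_piFinSuccAbove (fun _ : Fin (k + 2) => ℝ) 0).lintegral_comp_emb
      (MeasurableEquiv.measurableEmbedding _)]
    refine lintegral_congr fun z => ?_
    have hnn : 0 ≤ ∑ i : Fin (k + 1), z i.succ ^ 2 := Finset.sum_nonneg fun i _ => sq_nonneg _
    simp only [EuclideanSpace.norm_eq, Fin.sum_univ_succ (n := k + 1), Real.norm_eq_abs, sq_abs,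
      MeasurableEquiv.piFinSuccAbove_apply, Fin.insertNthEquiv_zero, Fin.consEquiv_symm_apply,
      Fin.tail, Real.sq_sqrt hnn]
  have hm : Measurable fun p : ℝ × (Fin (k + 1) → ℝ) =>
        g p.1 (Real.sqrt (p.1 ^ 2 + ‖(WithLp.toLp 2 p.2 : EuclideanSpace ℝ (Fin (k + 1)))‖ ^ 2)) :=
    hg.comp (f := fun p : ℝ × (Fin (k + 1) → ℝ) => (p.1,
      Real.sqrt (p.1 ^ 2 + ‖(WithLp.toLp 2 p.2 : EuclideanSpace ℝ (Fin (k + 1)))‖ ^ 2)))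
      (by fun_prop)
  rw [h1, h2, h3, Measure.volume_eq_prod, lintegral_prod _ hm.aemeasurable,
    ← lintegral_const_mul']
  swap
  · exact measure_ne_top _ _
  refine lintegral_congr fun y => ?_
  have h4 := (PiLp.volume_preserving_toLp (Fin (k + 1))).lintegral_comp_emb
      (MeasurableEquiv.toLp 2 (Fin (k + 1) → ℝ)).measurableEmbedding
      (fun z : EuclideanSpace ℝ (Fin (k + 1)) => g y (Real.sqrt (y ^ 2 + ‖z‖ ^ 2)))
  have h5 := lintegral_fun_norm_addHaar (volume : Measure (EuclideanSpace ℝ (Fin (k + 1))))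
      (f := fun r => g y (Real.sqrt (y ^ 2 + r ^ 2)))
      (hg.comp (f := fun r => (y, Real.sqrt (y ^ 2 + r ^ 2))) (by fun_prop))
  simp only [finrank_euclideanSpace, Fintype.card_fin, Nat.add_sub_cancel] at h5
  exact h4.trans h5

/-- Polar coordinates in the half plane. -/
theorem lintegral_halfPlane_polar (k : ℕ) {g : ℝ → ℝ → ℝ≥0∞}
    (hg : Measurable (Function.uncurry g)) :
    ∫⁻ y : ℝ, ∫⁻ r in Ioi (0 : ℝ), ENNReal.ofReal (r ^ k) * g y (Real.sqrt (y ^ 2 + r ^ 2)) =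
      ∫⁻ R in Ioi (0 : ℝ), ∫⁻ α in Ioo 0 Real.pi,
        ENNReal.ofReal (R ^ (k + 1)) * ENNReal.ofReal (Real.sin α ^ k) * g (R * Real.cos α) R := by
  have hg2 : Measurable fun p : ℝ × ℝ => g p.1 (Real.sqrt (p.1 ^ 2 + p.2 ^ 2)) :=
    hg.comp (f := fun p : ℝ × ℝ => (p.1, Real.sqrt (p.1 ^ 2 + p.2 ^ 2))) (by fun_prop)
  have hg3 : Measurable fun p : ℝ × ℝ => g (p.1 * Real.cos p.2) p.1 :=
    hg.comp (f := fun p : ℝ × ℝ => (p.1 * Real.cos p.2, p.1)) (by fun_prop)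
  set F : ℝ × ℝ → ℝ≥0∞ := fun p => (Ioi (0 : ℝ)).indicator (fun r => ENNReal.ofReal (r ^ k)) p.2 *
    g p.1 (Real.sqrt (p.1 ^ 2 + p.2 ^ 2)) with hF
  have hFm : Measurable F := by
    refine Measurable.mul ?_ hg2
    exact (Measurable.indicator (by fun_prop) measurableSet_Ioi).comp measurable_snd
  have h1 : ∫⁻ y : ℝ, ∫⁻ r in Ioi (0 : ℝ),
      ENNReal.ofReal (r ^ k) * g y (Real.sqrt (y ^ 2 + r ^ 2)) = ∫⁻ p, F p := by
    rw [Measure.volume_eq_prod, lintegral_prod _ hFm.aemeasurable]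
    refine lintegral_congr fun y => ?_
    rw [← lintegral_indicator measurableSet_Ioi]
    refine lintegral_congr fun r => ?_
    by_cases hr : r ∈ Ioi (0 : ℝ) <;> simp [hF, hr]
  have hGm : Measurable fun p : ℝ × ℝ => (Ioo 0 Real.pi).indicator (fun α =>
      ENNReal.ofReal (p.1 ^ (k + 1)) * ENNReal.ofReal (Real.sin α ^ k) *
        g (p.1 * Real.cos α) p.1) p.2 := by
    have : Measurable fun p : ℝ × ℝ => (Prod.snd ⁻¹' Ioo 0 Real.pi).indicator (fun p : ℝ × ℝ =>
      ENNReal.ofReal (p.1 ^ (k + 1)) * ENNReal.ofReal (Real.sin p.2 ^ k) *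
        g (p.1 * Real.cos p.2) p.1) p :=
      Measurable.indicator (Measurable.mul (by fun_prop) hg3) (measurable_snd measurableSet_Ioo)
    exact this
  rw [h1, ← lintegral_comp_polarCoord_symm]
  have h2 : ∀ p ∈ polarCoord.target, ENNReal.ofReal p.1 • F (polarCoord.symm p) =
      (Ioo 0 Real.pi).indicator (fun α => ENNReal.ofReal (p.1 ^ (k + 1)) *
        ENNReal.ofReal (Real.sin α ^ k) * g (p.1 * Real.cos α) p.1) p.2 := by
    rintro ⟨R, α⟩ ⟨hR, hα⟩
    simp only [mem_Ioi] at hR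
    have hs : Real.sqrt ((R * Real.cos α) ^ 2 + (R * Real.sin α) ^ 2) = R := by
      rw [show (R * Real.cos α) ^ 2 + (R * Real.sin α) ^ 2 = R ^ 2 by
        nlinarith [Real.sin_sq_add_cos_sq α], Real.sqrt_sq hR.le]
    simp only [hF, polarCoord_symm_apply, hs]
    by_cases h : α ∈ Ioo 0 Real.pi
    · have hsin : 0 < Real.sin α := Real.sin_pos_of_mem_Ioo h
      have h3 : R * Real.sin α ∈ Ioi (0 : ℝ) := mul_pos hR hsin
      rw [indicator_of_mem h, indicator_of_mem h3, smul_eq_mul, ← mul_assoc,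
        ← ENNReal.ofReal_mul hR.le, ← ENNReal.ofReal_mul (by positivity)]
      congr 2
      ring
    -- The lower half of the polar domain has nonpositive second coordinate, where the indicator in
    -- `F` vanishes.
    · have hα0 : α ≤ 0 := by
        by_contra h0
        exact h ⟨not_le.1 h0, hα.2⟩
      have hsin : Real.sin α ≤ 0 := Real.sin_nonpos_of_nonpos_of_neg_pi_le hα0 hα.1.le
      have h3 : R * Real.sin α ∉ Ioi (0 : ℝ) := not_lt.2 (mul_nonpos_of_nonneg_of_nonpos hR.le hsin)
      rw [indicator_of_notMem h, indicator_of_notMem h3]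
      simp
  rw [setLIntegral_congr_fun polarCoord.open_target.measurableSet h2]
  have h4 : polarCoord.target = Ioi (0 : ℝ) ×ˢ Ioo (-Real.pi) Real.pi := rfl
  rw [h4, Measure.volume_eq_prod, setLIntegral_prod _ hGm.aemeasurable]
  refine lintegral_congr fun R => ?_
  dsimp only
  rw [setLIntegral_indicator measurableSet_Ioo,
    inter_eq_left.2 (Ioo_subset_Ioo (by linarith [Real.pi_pos]) le_rfl)]

/-- The (unnormalised) law of the angle to a fixed direction. -/
def angleMass (k : ℕ) (B : Set ℝ) : ℝ≥0∞ :=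
  ∫⁻ α in Ioo 0 Real.pi ∩ Real.cos ⁻¹' B, ENNReal.ofReal (Real.sin α ^ k)

/-- In polar coordinates the radial and the angular integral separate. The radial factor `C` is the
same for all `u` and `B`; it is never evaluated, because it cancels on normalising. -/
theorem exists_volume_cone_eq (k : ℕ) : ∃ C : ℝ≥0∞,
    ∀ (u : EuclideanSpace ℝ (Fin (k + 2))), ‖u‖ = 1 → ∀ B : Set ℝ, MeasurableSet B →
      volume {x : EuclideanSpace ℝ (Fin (k + 2)) |
        (0 < ‖x‖ ∧ ‖x‖ < 1) ∧ inner ℝ u x / ‖x‖ ∈ B} = C * angleMass k B := by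
  refine ⟨(volume : Measure (EuclideanSpace ℝ (Fin (k + 1)))).toSphere univ *
    ∫⁻ R in Ioo (0 : ℝ) 1, ENNReal.ofReal (R ^ (k + 1)), fun u hu B hB => ?_⟩
  set S : Set (ℝ × ℝ) := {p | (0 < p.2 ∧ p.2 < 1) ∧ p.1 / p.2 ∈ B} with hS
  have hSm : MeasurableSet S := by
    refine MeasurableSet.inter ?_ ?_
    · exact measurable_snd (measurableSet_Ioo (a := (0 : ℝ)) (b := 1))
    · exact (measurable_fst.div measurable_snd) hB
  set g : ℝ → ℝ → ℝ≥0∞ := fun y r => S.indicator 1 (y, r) with hgdef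
  have hg : Measurable (Function.uncurry g) := by
    have : Function.uncurry g = S.indicator 1 := by ext ⟨y, r⟩; rfl
    rw [this]
    exact measurable_one.indicator hSm
  have h0 : volume {x : EuclideanSpace ℝ (Fin (k + 2)) |
        (0 < ‖x‖ ∧ ‖x‖ < 1) ∧ inner ℝ u x / ‖x‖ ∈ B} =
      ∫⁻ x : EuclideanSpace ℝ (Fin (k + 2)), g (inner ℝ u x) ‖x‖ := by
    rw [← lintegral_indicator_one]
    · rfl
    · exact (show Measurable fun x : EuclideanSpace ℝ (Fin (k + 2)) =>
        ((inner ℝ u x : ℝ), ‖x‖) by fun_prop) hSm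
  rw [h0, lintegral_inner_norm k hu hg, lintegral_halfPlane_polar k hg, mul_assoc]
  congr 1
  unfold angleMass
  rw [← lintegral_mul_const _ (by fun_prop), show Ioo (0 : ℝ) 1 = Iio 1 ∩ Ioi 0 by
    rw [inter_comm, Ioi_inter_Iio], ← setLIntegral_indicator measurableSet_Iio]
  refine setLIntegral_congr_fun measurableSet_Ioi fun R hR => ?_
  simp only [mem_Ioi] at hR
  by_cases hR1 : R ∈ Iio (1 : ℝ)
  · rw [indicator_of_mem hR1, inter_comm,
      ← setLIntegral_indicator (Real.measurable_cos hB), ← lintegral_const_mul]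
    · refine lintegral_congr fun α => ?_
      have : R * Real.cos α / R = Real.cos α := by field_simp
      have h6 : ((R * Real.cos α, R) ∈ S) ↔ α ∈ Real.cos ⁻¹' B := by
        simp only [hS, mem_ofPred_eq, this, mem_preimage]
        exact ⟨fun h => h.2, fun h => ⟨⟨hR, hR1⟩, h⟩⟩
      by_cases h7 : α ∈ Real.cos ⁻¹' B
      · simp only [hgdef, indicator_of_mem h7, indicator_of_mem (h6.2 h7), Pi.one_apply, mul_one]
      · simp only [hgdef, indicator_of_notMem h7, indicator_of_notMem (mt h6.1 h7), mul_zero]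
    · exact Measurable.indicator (by fun_prop) (Real.measurable_cos hB)
  · rw [indicator_of_notMem hR1]
    have : ∀ α, g (R * Real.cos α) R = 0 := fun α =>
      indicator_of_notMem (fun h => hR1 h.1.2) _
    simp [this]

theorem angleMass_univ (k : ℕ) : angleMass k univ = ENNReal.ofReal (sinInt k Real.pi) := by
  unfold angleMass sinInt
  rw [intervalIntegral.integral_of_le Real.pi_pos.le, ofReal_integral_eq_lintegral_ofReal]
  · rw [preimage_univ, inter_univ, restrict_Ioo_eq_restrict_Ioc]
  · exact ((Real.continuous_sin.pow k).integrableOn_Icc).mono_set Ioc_subset_Icc_self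
  · filter_upwards [ae_restrict_mem measurableSet_Ioc] with x hx
    exact pow_nonneg (Real.sin_nonneg_of_nonneg_of_le_pi hx.1.le hx.2) k

theorem uniformSphere_inner (k : ℕ) {u : EuclideanSpace ℝ (Fin (k + 2))} (hu : ‖u‖ = 1)
    {B : Set ℝ} (hB : MeasurableSet B) :
    uniformSphere (k + 2) {a | inner ℝ u (a : EuclideanSpace ℝ (Fin (k + 2))) ∈ B} =
      angleMass k B / ENNReal.ofReal (sinInt k Real.pi) := by
  obtain ⟨C, hC⟩ := exists_volume_cone_eq k
  have key : ∀ B : Set ℝ, MeasurableSet B →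
      (volume : Measure (EuclideanSpace ℝ (Fin (k + 2)))).toSphere
        {a | inner ℝ u (a : EuclideanSpace ℝ (Fin (k + 2))) ∈ B} =
      (k + 2 : ℕ) * (C * angleMass k B) := by
    intro B hB
    have hm : MeasurableSet {a : USphere (k + 2) |
        inner ℝ u (a : EuclideanSpace ℝ (Fin (k + 2))) ∈ B} :=
      (show Measurable fun a : USphere (k + 2) =>
        (inner ℝ u (a : EuclideanSpace ℝ (Fin (k + 2))) : ℝ) by fun_prop) hB
    rw [Measure.toSphere_apply' _ hm, ← hC u hu B hB, finrank_euclideanSpace, Fintype.card_fin]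
    congr 2
    ext x
    simp only [mem_smul, mem_image, mem_ofPred_eq]
    constructor
    · rintro ⟨r, hr, _, ⟨a, ha, rfl⟩, rfl⟩
      have hn : ‖(a : EuclideanSpace ℝ (Fin (k + 2)))‖ = 1 := by simp
      have hr0 : 0 < r := hr.1
      rw [norm_smul, hn, mul_one, Real.norm_of_nonneg hr0.le, inner_smul_right]
      refine ⟨hr, ?_⟩
      rwa [mul_div_cancel_left₀ _ hr0.ne']
    · rintro ⟨hx, hxB⟩
      refine ⟨‖x‖, hx, ‖x‖⁻¹ • x, ⟨⟨‖x‖⁻¹ • x, ?_⟩, ?_, rfl⟩, ?_⟩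
      · simp [norm_smul, hx.1.ne']
      · rw [inner_smul_right, inv_mul_eq_div]; exact hxB
      · rw [smul_smul, mul_inv_cancel₀ hx.1.ne', one_smul]
  -- The total mass contains the same factor `D`; it is neither 0 nor ∞ and cancels from the
  -- quotient.
  have huniv := key univ MeasurableSet.univ
  simp only [mem_univ, ofPred_true, angleMass_univ] at huniv
  have hne : (volume : Measure (EuclideanSpace ℝ (Fin (k + 2)))).toSphere univ ≠ 0 :=
    (Measure.measure_univ_ne_zero).2 (Measure.toSphere_ne_zero _)
  have hnt : (volume : Measure (EuclideanSpace ℝ (Fin (k + 2)))).toSphere univ ≠ ⊤ :=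
    measure_ne_top _ _
  have hI : ENNReal.ofReal (sinInt k Real.pi) ≠ 0 := by
    simpa using sinInt_pi_pos k
  unfold uniformSphere
  rw [Measure.smul_apply, key B hB, smul_eq_mul]
  set T := (volume : Measure (EuclideanSpace ℝ (Fin (k + 2)))).toSphere univ
  rw [← mul_assoc] at huniv
  set D : ℝ≥0∞ := (k + 2 : ℕ) * C
  rw [huniv] at hne hnt ⊢
  have hD0 : D ≠ 0 := left_ne_zero_of_mul hne
  have hDt : D ≠ ⊤ := fun h => hnt (by rw [h, ENNReal.top_mul hI])
  rw [show (k + 2 : ℕ) * (C * angleMass k B) = D * angleMass k B from (mul_assoc _ _ _).symm,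
    ENNReal.mul_inv (Or.inl hD0) (Or.inl hDt), mul_mul_mul_comm,
    ENNReal.inv_mul_cancel hD0 hDt, one_mul, ENNReal.div_eq_inv_mul]

theorem isProbabilityMeasure_uniformSphere (k : ℕ) :
    IsProbabilityMeasure (uniformSphere (k + 2)) := by
  constructor
  have hne : (volume : Measure (EuclideanSpace ℝ (Fin (k + 2)))).toSphere univ ≠ 0 :=
    (Measure.measure_univ_ne_zero).2 (Measure.toSphere_ne_zero _)
  unfold uniformSphere
  rw [Measure.smul_apply, smul_eq_mul, ENNReal.inv_mul_cancel hne (measure_ne_top _ _)]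

theorem lintegral_sin_pow (k : ℕ) {a b : ℝ} (ha : 0 ≤ a) (hab : a ≤ b) (hb : b ≤ Real.pi) :
    ∫⁻ α in Ioc a b, ENNReal.ofReal (Real.sin α ^ k) =
      ENNReal.ofReal (∫ α in a..b, Real.sin α ^ k) := by
  rw [intervalIntegral.integral_of_le hab, ofReal_integral_eq_lintegral_ofReal]
  · exact ((Real.continuous_sin.pow k).integrableOn_Icc).mono_set Ioc_subset_Icc_self
  · filter_upwards [ae_restrict_mem measurableSet_Ioc] with x hx
    exact pow_nonneg (Real.sin_nonneg_of_nonneg_of_le_pi (ha.trans hx.1.le) (hx.2.trans hb)) k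

/-- The uniform measure of the complement of a spherical cap. -/
theorem uniformSphere_inner_le (k : ℕ) {u : EuclideanSpace ℝ (Fin (k + 2))} (hu : ‖u‖ = 1)
    {t : ℝ} (ht : 0 ≤ t) :
    uniformSphere (k + 2) {a | inner ℝ u (a : EuclideanSpace ℝ (Fin (k + 2))) ≤ Real.exp (-t)} =
      ENNReal.ofReal (phi (k + 2) t) := by
  set ε := Real.exp (-t)
  have hε0 : 0 < ε := Real.exp_pos _
  have hε1 : ε ≤ 1 := Real.exp_le_one_iff.2 (by linarith)
  have hpi := sinInt_pi_pos k
  have hmass : angleMass k (Iic ε) = ENNReal.ofReal (sinInt k Real.pi - sinInt k (Real.arccos ε)) := by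
    have hint : sinInt k Real.pi - sinInt k (Real.arccos ε) =
        ∫ α in Real.arccos ε..Real.pi, Real.sin α ^ k :=
      intervalIntegral.integral_interval_sub_left
        ((Real.continuous_sin.pow k).intervalIntegrable _ _)
        ((Real.continuous_sin.pow k).intervalIntegrable _ _)
    rw [hint, ← lintegral_sin_pow k (Real.arccos_nonneg _) (Real.arccos_le_pi _) le_rfl]
    unfold angleMass
    refine setLIntegral_congr ?_
    refine (Filter.EventuallyEq.trans ?_ (Ioo_ae_eq_Ioc' (by simp)) :
      (_ : Set ℝ) =ᵐ[volume] Ioc (Real.arccos ε) Real.pi)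
    have hne : ∀ᵐ α : ℝ, α ≠ Real.arccos ε := by simp [ae_iff]
    filter_upwards [hne] with α hα
    refine propext ⟨fun ⟨h1, h2⟩ => ⟨?_, h1.2⟩, fun h => ⟨⟨?_, h.2⟩, ?_⟩⟩
    · have : Real.arccos ε ≤ α := by
        rw [← Real.arccos_cos h1.1.le h1.2.le]
        exact Real.arccos_le_arccos h2
      exact lt_of_le_of_ne this (Ne.symm hα)
    · exact (Real.arccos_nonneg _).trans_lt h.1
    · have h3 := Real.cos_le_cos_of_nonneg_of_le_pi (Real.arccos_nonneg ε) h.2.le h.1.le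
      rwa [Real.cos_arccos (by linarith) hε1] at h3
  have h := uniformSphere_inner k hu (measurableSet_Iic (a := ε))
  rw [hmass, ← ENNReal.ofReal_div_of_pos hpi] at h
  refine h.trans ?_
  congr 1
  unfold phi
  rw [sub_div, div_self hpi.ne']
  rfl

/-! ### Wallis estimate and equatorial bands -/

/-- Wallis: the recursion I_{k+2} = (k+1)/(k+2) · I_k makes the product independent of k. -/
theorem sinInt_pi_mul_succ (k : ℕ) :
    sinInt k Real.pi * sinInt (k + 1) Real.pi * (k + 1) = 2 * Real.pi := by
  induction k with
  | zero => simp [sinInt]; norm_num; ring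
  | succ k ih =>
    have h : sinInt (k + 2) Real.pi = (k + 1) / (k + 2) * sinInt k Real.pi := by
      simp [sinInt, integral_sin_pow]
    rw [show k + 1 + 1 = k + 2 from rfl, h, ← ih]
    push_cast
    have : (k : ℝ) + 2 ≠ 0 := by positivity
    field_simp
    ring

/-- I_k decreases in k, so the Wallis product gives I_k² (k+1) ≥ 2π, which exceeds 4. This is the
source of the factor √m. -/
theorem two_div_sqrt_le_sinInt_pi (k : ℕ) : 2 / Real.sqrt (k + 2) ≤ sinInt k Real.pi := by
  have h1 := sinInt_pi_mul_succ k
  have h2 : sinInt (k + 1) Real.pi ≤ sinInt k Real.pi := integral_sin_pow_succ_le k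
  have h3 := sinInt_pi_pos k
  have h4 : 2 * Real.pi ≤ sinInt k Real.pi ^ 2 * (k + 2) := by
    have h5 : sinInt k Real.pi * sinInt (k + 1) Real.pi ≤ sinInt k Real.pi ^ 2 := by nlinarith
    have hk : (0 : ℝ) ≤ k := Nat.cast_nonneg k
    nlinarith [sq_nonneg (sinInt k Real.pi)]
  rw [div_le_iff₀ (by positivity)]
  refine le_of_sq_le_sq ?_ (by positivity)
  rw [mul_pow, Real.sq_sqrt (by positivity)]
  nlinarith [Real.pi_gt_three]

theorem sinInt_one_band {δ : ℝ} (h0 : 0 ≤ δ) (h1 : δ ≤ 1) :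
    ∫ α in Real.arccos δ..Real.pi - Real.arccos δ, Real.sin α ^ 1 = 2 * δ := by
  simp [Real.cos_arccos (by linarith : -1 ≤ δ) h1]
  ring

/-- The uniform measure of an equatorial band. -/
theorem uniformSphere_abs_inner_le {k : ℕ} (hk : 1 ≤ k) {u : EuclideanSpace ℝ (Fin (k + 2))}
    (hu : ‖u‖ = 1) {δ : ℝ} (hδ : 0 ≤ δ) :
    uniformSphere (k + 2) {a | |inner ℝ u (a : EuclideanSpace ℝ (Fin (k + 2)))| ≤ δ} ≤
      ENNReal.ofReal (δ * Real.sqrt (k + 2)) := by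
  have := isProbabilityMeasure_uniformSphere k
  have hs : 1 ≤ Real.sqrt (k + 2) := by
    rw [Real.one_le_sqrt]
    have : (0 : ℝ) ≤ k := Nat.cast_nonneg k
    linarith
  rcases le_or_gt 1 δ with h1 | h1
  · refine prob_le_one.trans ?_
    rw [ENNReal.one_le_ofReal]
    nlinarith
  have hpi := sinInt_pi_pos k
  -- As k ≥ 1, sin^k ≤ sin on [0, π], and sin integrates to exactly 2δ over the band. This uses m ≥
  -- 3.
  have hmass : angleMass k (Icc (-δ) δ) ≤ ENNReal.ofReal (2 * δ) := by
    have hac : Real.arccos δ ≤ Real.pi / 2 := Real.arccos_le_pi_div_two.2 hδ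
    rw [← sinInt_one_band hδ h1.le, ← lintegral_sin_pow 1 (Real.arccos_nonneg _) (by linarith)
      (by linarith [Real.arccos_nonneg δ])]
    rw [setLIntegral_congr Ioc_ae_eq_Icc]
    unfold angleMass
    refine (setLIntegral_mono_ae (by fun_prop) (ae_of_all _ fun α hα => ?_)).trans
      (lintegral_mono_set (s := Ioo 0 Real.pi ∩ Real.cos ⁻¹' Icc (-δ) δ) ?_)
    · have := Real.sin_nonneg_of_nonneg_of_le_pi hα.1.1.le hα.1.2.le
      exact ENNReal.ofReal_le_ofReal
        (pow_le_pow_of_le_one this (Real.sin_le_one α) hk)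
    · rintro α ⟨h2, h3⟩
      rw [← Real.arccos_neg, ← Real.arccos_cos h2.1.le h2.2.le]
      exact ⟨Real.arccos_le_arccos h3.2, Real.arccos_le_arccos h3.1⟩
  have h := uniformSphere_inner k hu (measurableSet_Icc (a := -δ) (b := δ))
  have hset : {a : USphere (k + 2) | |inner ℝ u (a : EuclideanSpace ℝ (Fin (k + 2)))| ≤ δ} =
      {a : USphere (k + 2) | inner ℝ u (a : EuclideanSpace ℝ (Fin (k + 2))) ∈ Icc (-δ) δ} := by
    ext a
    rw [mem_ofPred_eq, mem_ofPred_eq, mem_Icc, abs_le]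
  rw [hset, h]
  refine (ENNReal.div_le_div_right hmass _).trans ?_
  rw [← ENNReal.ofReal_div_of_pos hpi]
  refine ENNReal.ofReal_le_ofReal ?_
  have h3 := two_div_sqrt_le_sinInt_pi k
  rw [div_le_iff₀ (by positivity)] at h3 ⊢
  nlinarith

/-! ### Measurability by projection, and a conditional product bound -/

/-- Projection along a compact factor is a closed map. It makes the events below, which ask for a
weight vector or a unit vector, measurable. -/
theorem isClosed_exists_of_isCompact {Y Z : Type*} [TopologicalSpace Y] [TopologicalSpace Z]
    {C : Set Y} (hC : IsCompact C) {Q : Set (Y × Z)} (hQ : IsClosed Q) :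
    IsClosed {z | ∃ y ∈ C, (y, z) ∈ Q} := by
  have : CompactSpace C := isCompact_iff_compactSpace.1 hC
  have h := isClosedMap_snd_of_compactSpace (X := C) (Y := Z) _
    (hQ.preimage (f := fun p : C × Z => ((p.1 : Y), p.2)) (by fun_prop))
  convert! h using 1
  ext z
  simp

/-- Fubini bound: conditionally on the coordinates in `p`, an event of the remaining coordinates
has probability at most `c`, and it is empty outside of `D`. -/
theorem pi_le_mul_of_section_le {ι X : Type*} [Fintype ι] [MeasurableSpace X] (μ : Measure X)
    [IsProbabilityMeasure μ] (p : ι → Prop) [DecidablePred p] [ι₁ : Fintype {i // p i}]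
    {E : Set (ι → X)}
    (hE : MeasurableSet E) {D : Set ({i // p i} → X)} (hD : MeasurableSet D) (c : ℝ≥0∞)
    (hsec : ∀ᵐ a ∂(Measure.pi fun _ : {i // p i} => μ), ∃ B : Set ({i // ¬ p i} → X),
      {b | (fun i => if h : p i then a ⟨i, h⟩ else b ⟨i, h⟩) ∈ E} ⊆ B ∧
        Measure.pi (fun _ : {i // ¬ p i} => μ) B ≤ c ∧ (B.Nonempty → a ∈ D)) :
    Measure.pi (fun _ : ι => μ) E ≤ c * Measure.pi (fun _ : {i // p i} => μ) D := by
  -- The instance is arbitrary in the statement, so that the bound also applies to the index type of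
  -- a `Finset`.
  obtain rfl : ι₁ = Subtype.fintype p := Subsingleton.elim _ _
  have h := (measurePreserving_piEquivPiSubtypeProd (fun _ : ι => μ) p).symm
  have hEm : MeasurableSet ((MeasurableEquiv.piEquivPiSubtypeProd (fun _ : ι => X) p).symm ⁻¹' E) :=
    (MeasurableEquiv.measurable _) hE
  rw [← h.measure_preimage hE.nullMeasurableSet, Measure.prod_apply hEm,
    ← lintegral_indicator_const hD]
  refine lintegral_mono_ae ?_
  filter_upwards [hsec] with a ha
  obtain ⟨B, hB, hBc, hBD⟩ := ha
  have hsub : Prod.mk a ⁻¹' ((MeasurableEquiv.piEquivPiSubtypeProd (fun _ : ι => X) p).symm ⁻¹' E)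
      ⊆ B := hB
  refine (measure_mono hsub).trans ?_
  by_cases haD : a ∈ D
  · rw [indicator_of_mem haD]; exact hBc
  · rw [not_nonempty_iff_eq_empty.1 (mt hBD haD), measure_empty]
    exact zero_le

theorem measurePreserving_pi_subtype {ι X : Type*} [Fintype ι] [MeasurableSpace X] (μ : Measure X)
    [IsProbabilityMeasure μ] (K : Finset ι) :
    MeasurePreserving (fun (a : ι → X) (i : K) => a i) (Measure.pi fun _ => μ)
      (Measure.pi fun _ => μ) := by
  classical
  have h := measurePreserving_fst.comp
    (measurePreserving_piEquivPiSubtypeProd (fun _ : ι => μ) (· ∈ K))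
  convert! h

/-! ### Few random unit vectors: near dependence and hulls close to the origin -/

section

variable {k : ℕ} {κ : Type*} [Fintype κ]

/-- Configurations for which the `i`-th vector is `δ`-close to a bounded combination of the
others. -/
def nearDependent (i : κ) (δ : ℝ) : Set (κ → USphere (k + 2)) :=
  {a | ∃ ν ∈ Icc (fun _ : κ => (-1 : ℝ)) (fun _ => 1), ν i = 1 ∧
    ‖∑ j, ν j • (a j : EuclideanSpace ℝ (Fin (k + 2)))‖ ≤ δ}

theorem isClosed_nearDependent (i : κ) (δ : ℝ) :
    IsClosed (nearDependent i δ : Set (κ → USphere (k + 2))) := by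
  refine isClosed_exists_of_isCompact isCompact_Icc
    (Q := {q : (κ → ℝ) × (κ → USphere (k + 2)) | q.1 i = 1 ∧
    ‖∑ j, q.1 j • (q.2 j : EuclideanSpace ℝ (Fin (k + 2)))‖ ≤ δ}) ?_
  have h1 : Continuous fun q : (κ → ℝ) × (κ → USphere (k + 2)) => q.1 i := by fun_prop
  have h2 : Continuous fun q : (κ → ℝ) × (κ → USphere (k + 2)) =>
    ‖∑ j, q.1 j • (q.2 j : EuclideanSpace ℝ (Fin (k + 2)))‖ := by fun_prop
  exact (isClosed_eq h1 continuous_const).inter (isClosed_le h2 continuous_const)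

theorem exists_unit_orthogonal {κ' : Type*} [Fintype κ'] (hc : Fintype.card κ' < k + 2)
    (v : κ' → EuclideanSpace ℝ (Fin (k + 2))) :
    ∃ u : EuclideanSpace ℝ (Fin (k + 2)), ‖u‖ = 1 ∧ ∀ j, inner ℝ u (v j) = 0 := by
  have hlt : Submodule.span ℝ (range v) ≠ ⊤ := by
    intro h
    have h1 := finrank_range_le_card (R := ℝ) v
    rw [Set.finrank, h, finrank_top, finrank_euclideanSpace, Fintype.card_fin] at h1
    omega
  obtain ⟨w, hw, hw0⟩ := Submodule.exists_mem_ne_zero_of_ne_bot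
    (mt (Submodule.orthogonal_eq_bot_iff).1 hlt)
  refine ⟨‖w‖⁻¹ • w, ?_, fun j => ?_⟩
  · rw [norm_smul, norm_inv, norm_norm, inv_mul_cancel₀ (norm_ne_zero_iff.2 hw0)]
  · rw [inner_smul_left, real_inner_comm, hw _ (Submodule.subset_span (mem_range_self j)), mul_zero]

/-- Fix all vectors but the `i`-th and take a unit `u` orthogonal to them. Pairing the combination
with `u` leaves ⟨u, a_i⟩, because `ν i = 1`, so `a i` lies in a band of half-width `δ`. The bounds
on `ν` only provide compactness. -/
theorem measure_nearDependent_le (hk : 1 ≤ k) (hc : Fintype.card κ ≤ k + 2) (i : κ) {δ : ℝ}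
    (hδ : 0 ≤ δ) :
    Measure.pi (fun _ : κ => uniformSphere (k + 2)) (nearDependent i δ) ≤
      ENNReal.ofReal (δ * Real.sqrt (k + 2)) := by
  classical
  have := isProbabilityMeasure_uniformSphere k
  refine (pi_le_mul_of_section_le (uniformSphere (k + 2)) (fun j => j ≠ i)
    (isClosed_nearDependent i δ).measurableSet MeasurableSet.univ
    (ENNReal.ofReal (δ * Real.sqrt (k + 2))) (ae_of_all _ fun a => ?_)).trans ?_
  · obtain ⟨u, hu, hu0⟩ := exists_unit_orthogonal (κ' := {j // j ≠ i})
      (lt_of_lt_of_le (Fintype.card_subtype_lt (x := i) (by simp)) hc)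
      (fun j => (a j : EuclideanSpace ℝ (Fin (k + 2))))
    have hii : ¬ (i ≠ i) := by simp
    refine ⟨(fun b : {j // ¬ (j ≠ i)} → USphere (k + 2) => b ⟨i, hii⟩) ⁻¹'
      {x | |inner ℝ u (x : EuclideanSpace ℝ (Fin (k + 2)))| ≤ δ}, ?_, ?_, fun _ => mem_univ _⟩
    · rintro b ⟨ν, -, hν1, hν⟩
      have hsum : inner ℝ u (∑ j, ν j • ((if h : j ≠ i then a ⟨j, h⟩ else b ⟨j, h⟩ :
          USphere (k + 2)) : EuclideanSpace ℝ (Fin (k + 2)))) =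
          inner ℝ u (b ⟨i, hii⟩ : EuclideanSpace ℝ (Fin (k + 2))) := by
        rw [inner_sum, Finset.sum_eq_single i]
        · simp [hν1]
        · intro j _ hj
          rw [dif_pos hj, inner_smul_right, hu0 ⟨j, hj⟩, mul_zero]
        · simp
      change |inner ℝ u (b ⟨i, hii⟩ : EuclideanSpace ℝ (Fin (k + 2)))| ≤ δ
      rw [← hsum]
      refine (abs_real_inner_le_norm _ _).trans ?_
      rw [hu, one_mul]
      exact hν
    · have hm : MeasurableSet {x : USphere (k + 2) |
          |inner ℝ u (x : EuclideanSpace ℝ (Fin (k + 2)))| ≤ δ} :=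
        (isClosed_le (by fun_prop) (by fun_prop)).measurableSet
      rw [(measurePreserving_eval (fun _ : {j // ¬ (j ≠ i)} => uniformSphere (k + 2))
        ⟨i, hii⟩).measure_preimage hm.nullMeasurableSet]
      exact uniformSphere_abs_inner_le hk hu hδ
  · rw [measure_univ, mul_one]

/-- A linear relation, divided by its coefficient of largest modulus, puts the configuration into
some `nearDependent i 0`, a null set. -/
theorem ae_linearIndependent (hk : 1 ≤ k) (hc : Fintype.card κ ≤ k + 2) :
    ∀ᵐ a ∂(Measure.pi fun _ : κ => uniformSphere (k + 2)),
      LinearIndependent ℝ (fun i => (a i : EuclideanSpace ℝ (Fin (k + 2)))) := by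
  have h0 : ∀ i : κ, ∀ᵐ a ∂(Measure.pi fun _ : κ => uniformSphere (k + 2)),
      a ∉ nearDependent i 0 := by
    intro i
    refine measure_eq_zero_iff_ae_notMem.1 (le_antisymm ?_ zero_le)
    simpa using measure_nearDependent_le (k := k) hk hc i le_rfl
  filter_upwards [ae_all_iff.2 h0] with a ha
  rw [Fintype.linearIndependent_iff]
  intro g hg
  by_contra hne
  push Not at hne
  obtain ⟨i₀, hi₀⟩ := hne
  obtain ⟨i, -, hi⟩ := Finset.exists_max_image Finset.univ (fun i => |g i|) ⟨i₀, Finset.mem_univ _⟩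
  have hgi : g i ≠ 0 := by
    intro h
    have := hi i₀ (Finset.mem_univ _)
    rw [h, abs_zero] at this
    exact hi₀ (abs_nonpos_iff.1 this)
  refine ha i ⟨fun j => g j / g i, ⟨fun j => ?_, fun j => ?_⟩, div_self hgi, ?_⟩
  · have : |g j / g i| ≤ 1 := by
      rw [abs_div]; exact div_le_one_of_le₀ (hi j (Finset.mem_univ _)) (abs_nonneg _)
    exact (abs_le.1 this).1
  · have : |g j / g i| ≤ 1 := by
      rw [abs_div]; exact div_le_one_of_le₀ (hi j (Finset.mem_univ _)) (abs_nonneg _)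
    exact (abs_le.1 this).2
  · have : ∑ j, (g j / g i) • (a j : EuclideanSpace ℝ (Fin (k + 2))) = 0 := by
      simp_rw [div_eq_inv_mul, mul_smul, ← Finset.smul_sum, hg, smul_zero]
    rw [this, norm_zero]

/-- Configurations whose convex hull comes `ε`-close to the origin. -/
def nearOrigin (κ : Type*) [Fintype κ] (ε : ℝ) : Set (κ → USphere (k + 2)) :=
  {a | ∃ w ∈ stdSimplex ℝ κ, ‖∑ j, w j • (a j : EuclideanSpace ℝ (Fin (k + 2)))‖ ≤ ε}

theorem isClosed_nearOrigin (ε : ℝ) :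
    IsClosed (nearOrigin κ ε : Set (κ → USphere (k + 2))) :=
  isClosed_exists_of_isCompact (isCompact_stdSimplex ℝ κ)
    (Q := {q : (κ → ℝ) × (κ → USphere (k + 2)) |
    ‖∑ j, q.1 j • (q.2 j : EuclideanSpace ℝ (Fin (k + 2)))‖ ≤ ε})
    (isClosed_le (by fun_prop) (by fun_prop))

/-- The largest weight is at least 1 / card κ; divide the convex combination by it. -/
theorem nearOrigin_subset (ε : ℝ) :
    (nearOrigin κ ε : Set (κ → USphere (k + 2))) ⊆ ⋃ i, nearDependent i (Fintype.card κ * ε) := by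
  rintro a ⟨w, hw, hwε⟩
  have hne : Nonempty κ := by
    by_contra h
    rw [not_nonempty_iff] at h
    simpa using hw.2
  obtain ⟨i, -, hi⟩ := Finset.exists_max_image Finset.univ w Finset.univ_nonempty
  have hcard : 1 ≤ Fintype.card κ * w i := by
    rw [← hw.2, ← nsmul_eq_mul]
    exact Finset.sum_le_card_nsmul _ _ _ fun j hj => hi j hj
  have hcpos : (0 : ℝ) < Fintype.card κ := by exact_mod_cast Fintype.card_pos
  have hwi : 0 < w i := by
    by_contra h
    nlinarith
  refine mem_iUnion.2 ⟨i, fun j => w j / w i, ⟨fun j => ?_, fun j => ?_⟩, div_self hwi.ne', ?_⟩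
  · have := div_nonneg (hw.1 j) hwi.le
    show -1 ≤ w j / w i
    linarith
  · exact div_le_one_of_le₀ (hi j (Finset.mem_univ _)) hwi.le
  · simp_rw [div_eq_inv_mul, mul_smul, ← Finset.smul_sum]
    rw [norm_smul, norm_inv, Real.norm_of_nonneg hwi.le, inv_mul_le_iff₀ hwi]
    have := (norm_nonneg _).trans hwε
    nlinarith

/-- One factor m comes from the union bound, one from dividing by the largest weight, and √m from
the band. -/
theorem measure_nearOrigin_le (hk : 1 ≤ k) (hc : Fintype.card κ ≤ k + 2) {ε : ℝ} (hε : 0 ≤ ε) :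
    Measure.pi (fun _ : κ => uniformSphere (k + 2)) (nearOrigin κ ε) ≤
      ENNReal.ofReal ((k + 2) * ((k + 2) * ε * Real.sqrt (k + 2))) := by
  have hc' : (Fintype.card κ : ℝ) ≤ k + 2 := by exact_mod_cast hc
  calc _ ≤ ∑ i, Measure.pi (fun _ : κ => uniformSphere (k + 2))
        (nearDependent i (Fintype.card κ * ε)) :=
        (measure_mono (nearOrigin_subset ε)).trans (measure_iUnion_fintype_le _ _)
    _ ≤ ∑ _i : κ, ENNReal.ofReal (Fintype.card κ * ε * Real.sqrt (k + 2)) :=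
        Finset.sum_le_sum fun i _ => measure_nearDependent_le hk hc i (by positivity)
    _ = ENNReal.ofReal (Fintype.card κ * (Fintype.card κ * ε * Real.sqrt (k + 2))) := by
        rw [Finset.sum_const, nsmul_eq_mul, ENNReal.ofReal_mul (p := Fintype.card κ) (by positivity),
          ENNReal.ofReal_natCast]
        rfl
    _ ≤ _ := by
        refine ENNReal.ofReal_le_ofReal ?_
        gcongr

theorem ae_forall_linearIndependent {ι : Type*} [Fintype ι] (hk : 1 ≤ k) :
    ∀ᵐ a ∂(Measure.pi fun _ : ι => uniformSphere (k + 2)), ∀ K : Finset ι, K.card ≤ k + 2 →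
      LinearIndependent ℝ (fun i : K => (a i : EuclideanSpace ℝ (Fin (k + 2)))) := by
  classical
  have := isProbabilityMeasure_uniformSphere k
  rw [ae_all_iff]
  intro K
  by_cases hK : K.card ≤ k + 2
  · have h := (measurePreserving_pi_subtype (uniformSphere (k + 2)) K).quasiMeasurePreserving.ae
      (ae_linearIndependent (κ := K) hk (by simpa using hK))
    filter_upwards [h] with a ha _
    exact ha
  · exact ae_of_all _ fun a h => absurd h hK

end

/-! ### Probability of the least-norm event for a fixed set of rows -/

/-- The configurations for which the point of smallest norm of the convex hull of the vectors
indexed by `K` has norm at most `ε` and bounds the remaining vectors. -/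
def minNormEvent {k : ℕ} {ι : Type*} (K : Finset ι) (ε σ : ℝ) : Set (ι → USphere (k + 2)) :=
  {a | ∃ w ∈ stdSimplex ℝ K, ∃ p : EuclideanSpace ℝ (Fin (k + 2)),
    p = ∑ i : K, w i • (a i : EuclideanSpace ℝ (Fin (k + 2))) ∧ ‖p‖ ≤ ε ∧
    (∀ i ∈ K, ‖p‖ ^ 2 ≤ inner ℝ p (a i : EuclideanSpace ℝ (Fin (k + 2)))) ∧
    ∀ j ∉ K, σ * inner ℝ p (a j : EuclideanSpace ℝ (Fin (k + 2))) ≤ ‖p‖ ^ 2}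

theorem isClosed_minNormEvent {k : ℕ} {ι : Type*} (K : Finset ι) (ε σ : ℝ) :
    IsClosed (minNormEvent K ε σ : Set (ι → USphere (k + 2))) := by
  let P : (K → ℝ) × (ι → USphere (k + 2)) → EuclideanSpace ℝ (Fin (k + 2)) :=
    fun q => ∑ i : K, q.1 i • (q.2 i : EuclideanSpace ℝ (Fin (k + 2)))
  have hP : Continuous P := by fun_prop
  have h := isClosed_exists_of_isCompact (isCompact_stdSimplex ℝ K)
    (Q := {q : (K → ℝ) × (ι → USphere (k + 2)) | ‖P q‖ ≤ ε ∧
      (∀ i ∈ K, ‖P q‖ ^ 2 ≤ inner ℝ (P q) (q.2 i : EuclideanSpace ℝ (Fin (k + 2)))) ∧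
      ∀ j ∉ K, σ * inner ℝ (P q) (q.2 j : EuclideanSpace ℝ (Fin (k + 2))) ≤ ‖P q‖ ^ 2}) ?_
  · convert! h using 1
    ext a
    simp [minNormEvent, P]
  · refine (isClosed_le hP.norm continuous_const).inter (IsClosed.inter ?_ ?_)
    · have h1 : ∀ i ∈ K, IsClosed {q : (K → ℝ) × (ι → USphere (k + 2)) |
          ‖P q‖ ^ 2 ≤ inner ℝ (P q) (q.2 i : EuclideanSpace ℝ (Fin (k + 2)))} :=
        fun i _ => isClosed_le (by fun_prop) (by fun_prop)
      have h2 : {q : (K → ℝ) × (ι → USphere (k + 2)) | ∀ i ∈ K,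
          ‖P q‖ ^ 2 ≤ inner ℝ (P q) (q.2 i : EuclideanSpace ℝ (Fin (k + 2)))} = ⋂ i ∈ (K : Set ι), {q |
          ‖P q‖ ^ 2 ≤ inner ℝ (P q) (q.2 i : EuclideanSpace ℝ (Fin (k + 2)))} := by
        ext q
        simp
      have h3 := isClosed_biInter h1
      rw [← h2] at h3
      exact h3
    · have h1 : ∀ i ∈ {i | i ∉ K}, IsClosed {q : (K → ℝ) × (ι → USphere (k + 2)) |
          σ * inner ℝ (P q) (q.2 i : EuclideanSpace ℝ (Fin (k + 2))) ≤ ‖P q‖ ^ 2} :=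
        fun i _ => isClosed_le (by fun_prop) (by fun_prop)
      have h2 : {q : (K → ℝ) × (ι → USphere (k + 2)) | ∀ i ∉ K,
          σ * inner ℝ (P q) (q.2 i : EuclideanSpace ℝ (Fin (k + 2))) ≤ ‖P q‖ ^ 2} = ⋂ i ∈ {i | i ∉ K}, {q |
          σ * inner ℝ (P q) (q.2 i : EuclideanSpace ℝ (Fin (k + 2))) ≤ ‖P q‖ ^ 2} := by
        ext q
        simp
      have h3 := isClosed_biInter h1
      rw [← h2] at h3
      exact h3

/-- The point of smallest norm of a convex hull is unique. -/
theorem minNorm_unique {F κ : Type*} [NormedAddCommGroup F] [InnerProductSpace ℝ F] [Fintype κ]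
    {a : κ → F} {w w' : κ → ℝ} (hw : w ∈ stdSimplex ℝ κ) (hw' : w' ∈ stdSimplex ℝ κ) {p p' : F}
    (hp : p = ∑ i, w i • a i) (hp' : p' = ∑ i, w' i • a i)
    (h : ∀ i, ‖p‖ ^ 2 ≤ inner ℝ p (a i)) (h' : ∀ i, ‖p'‖ ^ 2 ≤ inner ℝ p' (a i)) : p = p' := by
  -- Averaging the inequalities with the weights extends them from the vectors to the hull; applied
  -- both ways they force ‖p - p'‖² ≤ 0.
  have key : ∀ {w : κ → ℝ} {p q : F}, w ∈ stdSimplex ℝ κ → p = ∑ i, w i • a i →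
      (∀ i, ‖q‖ ^ 2 ≤ inner ℝ q (a i)) → ‖q‖ ^ 2 ≤ inner ℝ q p := by
    intro w p q hw hp hq
    rw [hp, inner_sum]
    simp_rw [inner_smul_right]
    calc ‖q‖ ^ 2 = ∑ i, w i * ‖q‖ ^ 2 := by rw [← Finset.sum_mul, hw.2, one_mul]
      _ ≤ _ := Finset.sum_le_sum fun i _ => mul_le_mul_of_nonneg_left (hq i) (hw.1 i)
  have h1 := key hw' hp' h
  have h2 := key hw hp h'
  have h3 := norm_sub_sq_real p p'
  rw [real_inner_comm] at h2
  have h4 : ‖p - p'‖ ^ 2 ≤ 0 := by linarith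
  have h5 : ‖p - p'‖ = 0 := by nlinarith [norm_nonneg (p - p'), sq_nonneg ‖p - p'‖]
  exact sub_eq_zero.1 (norm_eq_zero.1 h5)

/-- Given the vectors in `K`, the point p is determined by `minNorm_unique`. With u = σp/‖p‖, every
other vector satisfies ⟨u, a_j⟩ ≤ ‖p‖ ≤ ε, which has probability φ(t). The second factor bounds the
probability that such a p exists. -/
theorem measure_minNormEvent_le {k : ℕ} (hk : 1 ≤ k) {ι : Type*} [Fintype ι] {K : Finset ι}
    (hK : K.card = k + 2) {t σ : ℝ} (ht : 0 ≤ t) (hσ : |σ| = 1) :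
    Measure.pi (fun _ : ι => uniformSphere (k + 2)) (minNormEvent K (Real.exp (-t)) σ) ≤
      ENNReal.ofReal (phi (k + 2) t) ^ (Fintype.card ι - (k + 2)) *
        ENNReal.ofReal ((k + 2) * ((k + 2) * Real.exp (-t) * Real.sqrt (k + 2))) := by
  classical
  have := isProbabilityMeasure_uniformSphere k
  set ε := Real.exp (-t) with hεdef
  have hε : 0 < ε := Real.exp_pos _
  have hcard : Fintype.card {i // i ∈ K} ≤ k + 2 := by simp [hK]
  refine (pi_le_mul_of_section_le (uniformSphere (k + 2)) (· ∈ K)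
    (isClosed_minNormEvent K ε σ).measurableSet
    (isClosed_nearOrigin (κ := {i // i ∈ K}) ε).measurableSet
    (ENNReal.ofReal (phi (k + 2) t) ^ (Fintype.card ι - (k + 2))) ?_).trans
    (mul_le_mul_right (measure_nearOrigin_le hk hcard hε.le) _)
  filter_upwards [ae_linearIndependent (κ := {i // i ∈ K}) hk hcard] with a ha
  by_cases hne : ∃ w ∈ stdSimplex ℝ K, ∃ p : EuclideanSpace ℝ (Fin (k + 2)),
    p = ∑ i : K, w i • (a i : EuclideanSpace ℝ (Fin (k + 2))) ∧ ‖p‖ ≤ ε ∧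
    (∀ i : K, ‖p‖ ^ 2 ≤ inner ℝ p (a i : EuclideanSpace ℝ (Fin (k + 2))))
  swap
  -- Without a suitable p for these vectors, the section of the event is empty.
  · refine ⟨∅, ?_, by simp, by simp⟩
    rintro b ⟨w, hw, p, hp, hpε, hpK, -⟩
    refine hne ⟨w, hw, p, ?_, hpε, fun i => ?_⟩
    · simpa using hp
    · simpa using hpK i i.2
  obtain ⟨w, hw, p, hp, hpε, hpK⟩ := hne
  -- Linear independence, valid almost surely, excludes p = 0, so that p can be normalised.
  have hp0 : 0 < ‖p‖ := by
    rw [norm_pos_iff]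
    intro h0
    have h1 := Fintype.linearIndependent_iff.1 ha w (by rw [← hp, h0])
    have h2 := hw.2
    simp [h1] at h2
  set u := (σ * ‖p‖⁻¹) • p with hu
  have hu1 : ‖u‖ = 1 := by
    rw [hu, norm_smul, Real.norm_eq_abs, abs_mul, hσ, one_mul, abs_of_pos (inv_pos.2 hp0),
      inv_mul_cancel₀ hp0.ne']
  refine ⟨univ.pi fun _ => {x | inner ℝ u (x : EuclideanSpace ℝ (Fin (k + 2))) ≤ ε}, ?_, ?_,
    fun _ => ⟨w, hw, hp ▸ hpε⟩⟩
  · rintro b ⟨w', hw', p', hp', -, hpK', hj⟩ ⟨j, hjK⟩ -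
    have hpp : p = p' := by
      refine minNorm_unique (a := fun i : K => (a i : EuclideanSpace ℝ (Fin (k + 2)))) hw hw' hp
        (by simpa using hp') hpK fun i => ?_
      simpa using hpK' i i.2
    subst hpp
    have h1 := hj j hjK
    simp only [dif_neg hjK] at h1
    show inner ℝ u (b ⟨j, hjK⟩ : EuclideanSpace ℝ (Fin (k + 2))) ≤ ε
    rw [hu, real_inner_smul_left, mul_comm σ, mul_assoc, inv_mul_le_iff₀ hp0]
    nlinarith
  · rw [Measure.pi_pi]
    simp only [Finset.prod_const, Finset.card_univ]
    rw [uniformSphere_inner_le k hu1 ht, Fintype.card_subtype_compl, Fintype.card_coe, hK]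

/-! ### The angle θ(A) as a min-max of inner products -/

theorem row_matrixOfRows {n m : ℕ} (a : Fin n → USphere m) (i : Fin n) :
    row (matrixOfRows a) i = a i := rfl

/-- `cos θ(A)` is the minimum over the unit sphere of the support function of the rows. -/
theorem exists_cos_theta {n m : ℕ} (hn : 0 < n) (a : Fin n → USphere m) :
    ∃ x₀ : EuclideanSpace ℝ (Fin m), ‖x₀‖ = 1 ∧
      (∀ i, inner ℝ x₀ (a i : EuclideanSpace ℝ (Fin m)) ≤ Real.cos (theta (matrixOfRows a))) ∧
      ∀ x : EuclideanSpace ℝ (Fin m), ‖x‖ = 1 →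
        ∃ i, Real.cos (theta (matrixOfRows a)) ≤ inner ℝ x (a i : EuclideanSpace ℝ (Fin m)) := by
  have : Nonempty (Fin n) := ⟨⟨0, hn⟩⟩
  have hna : ∀ i, ‖(a i : EuclideanSpace ℝ (Fin m))‖ = 1 := fun i => by simp
  let M : EuclideanSpace ℝ (Fin m) → ℝ := fun x => Finset.univ.sup' Finset.univ_nonempty
    fun i => inner ℝ x (a i : EuclideanSpace ℝ (Fin m))
  have hM : Continuous M := Continuous.finset_sup'_apply _ fun i _ => by fun_prop
  obtain ⟨x₀, hx₀, hmin⟩ := (isCompact_sphere (0 : EuclideanSpace ℝ (Fin m)) 1).exists_isMinOn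
    ⟨a ⟨0, hn⟩, (a ⟨0, hn⟩).2⟩ hM.continuousOn
  have hx₀1 : ‖x₀‖ = 1 := by simpa using hx₀
  have hle : ∀ i, inner ℝ x₀ (a i : EuclideanSpace ℝ (Fin m)) ≤ M x₀ := fun i =>
    Finset.le_sup' (fun i => inner ℝ x₀ (a i : EuclideanSpace ℝ (Fin m))) (Finset.mem_univ i)
  have hex : ∀ x : EuclideanSpace ℝ (Fin m), ‖x‖ = 1 →
      ∃ i, M x₀ ≤ inner ℝ x (a i : EuclideanSpace ℝ (Fin m)) := by
    intro x hx
    obtain ⟨i, -, hi⟩ := Finset.exists_mem_eq_sup' Finset.univ_nonempty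
      fun i => inner ℝ x (a i : EuclideanSpace ℝ (Fin m))
    refine ⟨i, ?_⟩
    rw [← hi]
    exact hmin (by simpa using hx)
  -- The value must lie in [-1, 1] for `Real.cos` to undo `Real.arccos`.
  have hcl : -1 ≤ M x₀ := by
    refine le_trans ?_ (hle ⟨0, hn⟩)
    have := abs_le.1 (abs_real_inner_le_norm x₀ (a ⟨0, hn⟩ : EuclideanSpace ℝ (Fin m)))
    rw [hx₀1, hna] at this
    linarith [this.1]
  have hcu : M x₀ ≤ 1 := by
    obtain ⟨i, hi⟩ := hex x₀ hx₀1
    have := (le_abs_self _).trans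
      (abs_real_inner_le_norm x₀ (a i : EuclideanSpace ℝ (Fin m)))
    rw [hx₀1, hna] at this
    linarith
  have hangle : ∀ i x, x ≠ 0 → InnerProductGeometry.angle (row (matrixOfRows a) i) x =
      Real.arccos (inner ℝ (‖x‖⁻¹ • x) (a i : EuclideanSpace ℝ (Fin m))) := by
    intro i x hx
    rw [row_matrixOfRows, InnerProductGeometry.angle_comm, InnerProductGeometry.angle, hna, mul_one,
      real_inner_smul_left, inv_mul_eq_div]
  have hbdd : ∀ x, BddBelow (range fun i => InnerProductGeometry.angle (row (matrixOfRows a) i) x) :=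
    fun x => ⟨0, by rintro _ ⟨i, rfl⟩; exact InnerProductGeometry.angle_nonneg _ _⟩
  have hup : ∀ x : {x : EuclideanSpace ℝ (Fin m) // x ≠ 0},
      thetaAt (matrixOfRows a) x ≤ Real.arccos (M x₀) := by
    rintro ⟨x, hx⟩
    obtain ⟨i, hi⟩ := hex (‖x‖⁻¹ • x) (by
      rw [norm_smul, norm_inv, norm_norm, inv_mul_cancel₀ (norm_ne_zero_iff.2 hx)])
    refine (ciInf_le (hbdd x) i).trans ?_
    rw [hangle i x hx]
    exact Real.arccos_le_arccos hi
  have hx₀0 : x₀ ≠ 0 := by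
    rintro rfl
    simp at hx₀1
  have hlow : Real.arccos (M x₀) ≤ thetaAt (matrixOfRows a) x₀ := by
    refine le_ciInf fun i => ?_
    rw [hangle i x₀ hx₀0, hx₀1, inv_one, one_smul]
    exact Real.arccos_le_arccos (hle i)
  have hne : Nonempty {x : EuclideanSpace ℝ (Fin m) // x ≠ 0} := ⟨⟨x₀, hx₀0⟩⟩
  have hθ : theta (matrixOfRows a) = Real.arccos (M x₀) := by
    refine le_antisymm (ciSup_le hup) (hlow.trans ?_)
    exact le_ciSup (f := fun x : {x : EuclideanSpace ℝ (Fin m) // x ≠ 0} =>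
      thetaAt (matrixOfRows a) x) ⟨_, by rintro _ ⟨x, rfl⟩; exact hup x⟩ ⟨x₀, hx₀0⟩
  have hcos : Real.cos (theta (matrixOfRows a)) = M x₀ := by rw [hθ, Real.cos_arccos hcl hcu]
  rw [hcos]
  exact ⟨x₀, hx₀1, hle, hex⟩

/-- By the min-max formula, cos θ ≤ r means that some unit x has all ⟨x, a_i⟩ ≤ r: a closed
condition projected along the compact sphere. -/
theorem measurable_cos_theta {n m : ℕ} (hn : 0 < n) :
    Measurable fun a : Fin n → USphere m => Real.cos (theta (matrixOfRows a)) := by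
  refine measurable_of_Iic fun r => ?_
  have h : (fun a : Fin n → USphere m => Real.cos (theta (matrixOfRows a))) ⁻¹' Iic r =
      {a | ∃ x ∈ Metric.sphere (0 : EuclideanSpace ℝ (Fin m)) 1, (x, a) ∈ ⋂ i : Fin n,
        {q : EuclideanSpace ℝ (Fin m) × (Fin n → USphere m) |
          inner ℝ q.1 (q.2 i : EuclideanSpace ℝ (Fin m)) ≤ r}} := by
    ext a
    obtain ⟨x₀, hx₀, h1, h2⟩ := exists_cos_theta hn a
    simp only [mem_preimage, mem_Iic, mem_ofPred_eq, mem_iInter, mem_sphere_zero_iff_norm]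
    constructor
    · exact fun h => ⟨x₀, hx₀, fun i => (h1 i).trans h⟩
    · rintro ⟨x, hx, hxr⟩
      obtain ⟨i, hi⟩ := h2 x hx
      exact hi.trans (hxr i)
  rw [h]
  exact (isClosed_exists_of_isCompact (isCompact_sphere _ _)
    (isClosed_iInter fun i => isClosed_le (by fun_prop) (by fun_prop))).measurableSet

/-! ### Carathéodory on supporting hyperplanes -/

section

variable {F ι : Type*} [NormedAddCommGroup F] [InnerProductSpace ℝ F]

/-- Carathéodory's theorem for a family of vectors. -/
theorem exists_affineIndependent_of_mem_convexHull_range {a : ι → F} {p : F}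
    (hp : p ∈ convexHull ℝ (range a)) :
    ∃ (I : Finset ι) (w : ι → ℝ), (∀ i ∈ I, 0 < w i) ∧ ∑ i ∈ I, w i = 1 ∧
      ∑ i ∈ I, w i • a i = p ∧ AffineIndependent ℝ (fun i : I => a i) := by
  classical
  obtain ⟨κ, _, z, w, hz, hind, hw, hw1, hwp⟩ := eq_pos_convex_span_of_mem_convexHull hp
  choose f hf using fun i => hz (mem_range_self i)
  have hzf : z = a ∘ f := funext fun i => (hf i).symm
  have hfinj : Function.Injective f := fun i j hij => hind.injective (by rw [← hf, ← hf, hij])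
  refine ⟨Finset.univ.map ⟨f, hfinj⟩, Function.extend f w 0, ?_, ?_, ?_, ?_⟩
  · simp only [Finset.mem_map, Finset.mem_univ, true_and, Function.Embedding.coeFn_mk]
    rintro _ ⟨i, rfl⟩
    rw [hfinj.extend_apply]
    exact hw i
  · simp [hfinj.extend_apply, hw1]
  · simp [hfinj.extend_apply, hf, hwp]
  · have h := hind.range
    have hemb : ∀ i : (Finset.univ.map (⟨f, hfinj⟩ : κ ↪ ι) : Finset ι), a i ∈ range z := by
      rintro ⟨i, hi⟩
      simp only [Finset.mem_map, Finset.mem_univ, true_and, Function.Embedding.coeFn_mk] at hi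
      obtain ⟨j, rfl⟩ := hi
      exact ⟨j, (hf j).symm⟩
    refine h.comp_embedding ⟨fun i : (Finset.univ.map (⟨f, hfinj⟩ : κ ↪ ι) : Finset ι) =>
      ⟨a i, hemb i⟩, ?_⟩
    rintro ⟨i, hi⟩ ⟨j, hj⟩ hij
    simp only [Finset.mem_map, Finset.mem_univ, true_and, Function.Embedding.coeFn_mk] at hi hj
    obtain ⟨i, rfl⟩ := hi
    obtain ⟨j, rfl⟩ := hj
    simp only [Subtype.mk.injEq, hf] at hij
    rw [Subtype.mk.injEq, hind.injective hij]

/-- Carathéodory's theorem on a supporting hyperplane not containing the origin. -/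
theorem exists_linearIndependent_face {a : ι → F} {p : F} (hp : p ∈ convexHull ℝ (range a))
    (hp0 : p ≠ 0) {σ : ℝ} (hσ : σ ≠ 0) (h : ∀ i, 0 ≤ σ * (inner ℝ p (a i) - ‖p‖ ^ 2)) :
    ∃ (I : Finset ι) (w : ι → ℝ), (∀ i ∈ I, 0 < w i) ∧ ∑ i ∈ I, w i = 1 ∧
      ∑ i ∈ I, w i • a i = p ∧ (∀ i ∈ I, inner ℝ p (a i) = ‖p‖ ^ 2) ∧
      LinearIndependent ℝ (fun i : I => a i) := by
  obtain ⟨I, w, hw, hw1, hwp, hind⟩ := exists_affineIndependent_of_mem_convexHull_range hp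
  have hpp : ‖p‖ ^ 2 ≠ 0 := pow_ne_zero 2 (norm_ne_zero_iff.2 hp0)
  -- A sum of nonnegative terms that vanishes, since p itself lies on the hyperplane; hence every
  -- point of positive weight lies on it.
  have hsum : ∑ i ∈ I, w i * (σ * (inner ℝ p (a i) - ‖p‖ ^ 2)) = 0 := by
    have h1 : ∑ i ∈ I, w i * inner ℝ p (a i) = ‖p‖ ^ 2 := by
      rw [← real_inner_self_eq_norm_sq, ← hwp, inner_sum, hwp]
      simp_rw [inner_smul_right]
    calc _ = σ * (∑ i ∈ I, w i * inner ℝ p (a i) - (∑ i ∈ I, w i) * ‖p‖ ^ 2) := by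
          rw [Finset.sum_mul, ← Finset.sum_sub_distrib, Finset.mul_sum]
          exact Finset.sum_congr rfl fun i _ => by ring
      _ = 0 := by rw [h1, hw1]; ring
  have heq : ∀ i ∈ I, inner ℝ p (a i) = ‖p‖ ^ 2 := by
    intro i hi
    have := (Finset.sum_eq_zero_iff_of_nonneg fun j hj => mul_nonneg (hw j hj).le (h j)).1 hsum i hi
    have := (mul_eq_zero.1 this).resolve_left (hw i hi).ne'
    linarith [(mul_eq_zero.1 this).resolve_left hσ]
  refine ⟨I, w, hw, hw1, hwp, heq, ?_⟩
  rw [Fintype.linearIndependent_iff]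
  intro g hg
  -- The hyperplane misses the origin: pairing a linear relation with p shows that its coefficients
  -- sum to 0, so affine independence becomes linear independence.
  have hg0 : ∑ i, g i = 0 := by
    have h2 : ∑ i : I, g i * ‖p‖ ^ 2 = 0 := by
      have h3 : inner ℝ p (∑ i : I, g i • a i) = 0 := by rw [hg, inner_zero_right]
      rw [inner_sum] at h3
      rw [← h3]
      exact Finset.sum_congr rfl fun i _ => by rw [inner_smul_right, heq i i.2]
    rw [← Finset.sum_mul] at h2
    exact (mul_eq_zero.1 h2).resolve_right hpp
  intro i
  refine (affineIndependent_iff.1 hind) Finset.univ g hg0 hg i (Finset.mem_univ i)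

/-- The convex hull contains the ball whose radius bounds the support function from below. -/
theorem mem_convexHull_of_norm_le [Finite ι] [CompleteSpace F] {a : ι → F} {c : ℝ}
    (h : ∀ x : F, ‖x‖ = 1 → ∃ i, c ≤ inner ℝ x (a i)) {p : F} (hp : ‖p‖ ≤ c)
    (hne : (range a).Nonempty) :
    p ∈ convexHull ℝ (range a) := by
  by_contra hmem
  -- A separating direction y, normalised, would have all ⟨y, a_i⟩ < ⟨y, p⟩ ≤ ‖p‖ ≤ c, against `h`.
  obtain ⟨f, r, hf, hr⟩ := geometric_hahn_banach_closed_point (convex_convexHull ℝ (range a))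
    ((finite_range a).isCompact_convexHull ℝ).isClosed hmem
  set y := (InnerProductSpace.toDual ℝ F).symm f with hy
  have hfy : ∀ x, f x = inner ℝ y x := fun x => by
    rw [hy, InnerProductSpace.toDual_symm_apply]
  have hlt : ∀ i, inner ℝ y (a i) < inner ℝ y p := fun i => by
    rw [← hfy, ← hfy]
    exact (hf _ (subset_convexHull ℝ _ (mem_range_self i))).trans hr
  have hy0 : 0 < ‖y‖ := by
    rw [norm_pos_iff]
    intro h0
    obtain ⟨_, i, rfl⟩ := hne
    simpa [h0] using hlt i
  obtain ⟨i, hi⟩ := h (‖y‖⁻¹ • y) (by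
    rw [norm_smul, norm_inv, norm_norm, inv_mul_cancel₀ hy0.ne'])
  rw [real_inner_smul_left, le_inv_mul_iff₀ hy0] at hi
  have h2 := real_inner_le_norm y p
  nlinarith [hlt i]

end

/-! ### Every ill-conditioned configuration in general position lies in a least-norm event -/

section

variable {k : ℕ} {ι : Type*}

theorem mem_minNormEvent_of_subset [DecidableEq ι] {a : ι → USphere (k + 2)} {I K : Finset ι}
    (hIK : I ⊆ K) {w : ι → ℝ} (hw : ∀ i ∈ I, 0 < w i) (hw1 : ∑ i ∈ I, w i = 1)
    {p : EuclideanSpace ℝ (Fin (k + 2))}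
    (hp : ∑ i ∈ I, w i • (a i : EuclideanSpace ℝ (Fin (k + 2))) = p) {ε σ : ℝ} (hpε : ‖p‖ ≤ ε)
    (hK : ∀ i ∈ K, ‖p‖ ^ 2 ≤ inner ℝ p (a i : EuclideanSpace ℝ (Fin (k + 2))))
    (hσ : ∀ j, σ * inner ℝ p (a j : EuclideanSpace ℝ (Fin (k + 2))) ≤ ‖p‖ ^ 2) :
    a ∈ minNormEvent K ε σ := by
  refine ⟨fun i => if (i : ι) ∈ I then w i else 0, ⟨fun i => ?_, ?_⟩, p, ?_, hpε, hK,
    fun j _ => hσ j⟩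
  · dsimp only
    split_ifs with h
    · exact (hw i h).le
    · exact le_rfl
  · rw [Finset.sum_coe_sort K (fun i => if i ∈ I then w i else 0), ← hw1, Finset.sum_ite_mem,
      Finset.inter_eq_right.2 hIK]
  · rw [Finset.sum_coe_sort K (fun i => (if i ∈ I then w i else 0) •
      (a i : EuclideanSpace ℝ (Fin (k + 2)))), ← hp]
    simp_rw [ite_smul, zero_smul]
    rw [Finset.sum_ite_mem, Finset.inter_eq_right.2 hIK]

variable {a : ι → USphere (k + 2)} {c : ℝ} {x₀ : EuclideanSpace ℝ (Fin (k + 2))}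

/-- If 0 is a positive combination of some a_i, pairing with `x₀` shows that these are all
orthogonal to `x₀`. At most k + 2 of them would be linearly dependent; more of them would contain a
basis orthogonal to a unit vector. -/
theorem zero_notMem_convexHull (hx₀ : ‖x₀‖ = 1)
    (hle : ∀ i, inner ℝ x₀ (a i : EuclideanSpace ℝ (Fin (k + 2))) ≤ 0)
    (hgp : ∀ K : Finset ι, K.card ≤ k + 2 →
      LinearIndependent ℝ (fun i : K => (a i : EuclideanSpace ℝ (Fin (k + 2))))) :
    (0 : EuclideanSpace ℝ (Fin (k + 2))) ∉
      convexHull ℝ (range fun i => (a i : EuclideanSpace ℝ (Fin (k + 2)))) := by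
  intro hmem
  obtain ⟨I, w, hw, hw1, hwp, -⟩ := exists_affineIndependent_of_mem_convexHull_range hmem
  have hsum : ∑ i ∈ I, w i * -inner ℝ x₀ (a i : EuclideanSpace ℝ (Fin (k + 2))) = 0 := by
    have h1 : inner ℝ x₀ (∑ i ∈ I, w i • (a i : EuclideanSpace ℝ (Fin (k + 2)))) = 0 := by
      rw [hwp, inner_zero_right]
    rw [inner_sum] at h1
    simp_rw [inner_smul_right] at h1
    simp_rw [mul_neg, Finset.sum_neg_distrib, h1, neg_zero]
  have hperp : ∀ i ∈ I, inner ℝ x₀ (a i : EuclideanSpace ℝ (Fin (k + 2))) = 0 := by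
    intro i hi
    have := (Finset.sum_eq_zero_iff_of_nonneg fun j hj =>
      mul_nonneg (hw j hj).le (neg_nonneg.2 (hle j))).1 hsum i hi
    exact neg_eq_zero.1 ((mul_eq_zero.1 this).resolve_left (hw i hi).ne')
  rcases le_or_gt I.card (k + 2) with hI | hI
  · have h1 := Fintype.linearIndependent_iff.1 (hgp I hI) (fun i => w i) (by
      rw [Finset.sum_coe_sort I (fun i => w i • (a i : EuclideanSpace ℝ (Fin (k + 2)))), hwp])
    have h2 : ∑ i ∈ I, w i = 0 := Finset.sum_eq_zero fun i hi => h1 ⟨i, hi⟩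
    linarith
  · obtain ⟨K, hKI, hK⟩ := Finset.exists_subset_card_eq hI.le
    have hspan := (hgp K hK.le).span_eq_top_of_card_eq_finrank' (by simp [hK])
    have hz : x₀ ∈ (Submodule.span ℝ (range fun i : K =>
        (a i : EuclideanSpace ℝ (Fin (k + 2)))))ᗮ := by
      rw [Submodule.mem_orthogonal']
      intro v hv
      induction hv using Submodule.span_induction with
      | mem v hv =>
        obtain ⟨i, rfl⟩ := hv
        exact hperp i (hKI i.2)
      | zero => exact inner_zero_right _
      | add v v' _ _ h h' => rw [inner_add_right, h, h', add_zero]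
      | smul r v _ h => rw [inner_smul_right, h, mul_zero]
    rw [hspan, Submodule.top_orthogonal_eq_bot, Submodule.mem_bot] at hz
    simp [hz] at hx₀

variable [Fintype ι]

/-- The rows attaining a positive minimum of the support function are at least as many as the
dimension. -/
theorem card_active_ge [DecidableEq ι] (hx₀ : ‖x₀‖ = 1)
    (hle : ∀ i, inner ℝ x₀ (a i : EuclideanSpace ℝ (Fin (k + 2))) ≤ c)
    (hex : ∀ x : EuclideanSpace ℝ (Fin (k + 2)), ‖x‖ = 1 →
      ∃ i, c ≤ inner ℝ x (a i : EuclideanSpace ℝ (Fin (k + 2)))) (hc : 0 < c) {I J : Finset ι}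
    (hJ : ∀ i, i ∉ J → inner ℝ x₀ (a i : EuclideanSpace ℝ (Fin (k + 2))) ≠ c) (hIJ : I ⊆ J)
    {w : ι → ℝ} (hp : ∑ i ∈ I, w i • (a i : EuclideanSpace ℝ (Fin (k + 2))) = c • x₀) :
    k + 2 ≤ J.card := by
  -- Otherwise some unit u is orthogonal to all vectors in `J`, hence to `x₀`. For small s > 0, y =
  -- x₀ + s u still has all ⟨y, a_i⟩ ≤ c but ‖y‖ > 1, so y/‖y‖ beats the minimum c.
  by_contra! hcard
  obtain ⟨u, hu, hu0⟩ := exists_unit_orthogonal (κ' := J) (by simpa using hcard)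
    (fun j => (a j : EuclideanSpace ℝ (Fin (k + 2))))
  have hux : inner ℝ x₀ u = 0 := by
    have h1 : inner ℝ u (c • x₀) = 0 := by
      rw [← hp, inner_sum]
      refine Finset.sum_eq_zero fun i hi => ?_
      rw [inner_smul_right, hu0 ⟨i, hIJ hi⟩, mul_zero]
    rw [inner_smul_right] at h1
    rw [real_inner_comm]
    exact (mul_eq_zero.1 h1).resolve_left hc.ne'
  have hev : ∀ᶠ s : ℝ in nhdsWithin 0 (Ioi 0), ∀ i,
      inner ℝ (x₀ + s • u) (a i : EuclideanSpace ℝ (Fin (k + 2))) ≤ c := by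
    rw [Filter.eventually_all]
    intro i
    by_cases hi : i ∈ J
    · refine Filter.Eventually.of_forall fun s => ?_
      rw [inner_add_left, real_inner_smul_left, hu0 ⟨i, hi⟩, mul_zero, add_zero]
      exact hle i
    · have hlt := lt_of_le_of_ne (hle i) (hJ i hi)
      have hcont : Continuous fun s : ℝ =>
        (inner ℝ (x₀ + s • u) (a i : EuclideanSpace ℝ (Fin (k + 2))) : ℝ) := by fun_prop
      have h2 := (hcont.tendsto 0).eventually_lt_const (u := c) (by simpa using hlt)
      filter_upwards [nhdsWithin_le_nhds h2] with s hs using hs.le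
  obtain ⟨s, hs, hs0⟩ := (hev.and self_mem_nhdsWithin).exists
  have hs0 : 0 < s := hs0
  set y := x₀ + s • u
  have hy : 1 < ‖y‖ ^ 2 := by
    rw [norm_add_sq_real, inner_smul_right, hux, norm_smul, hx₀, hu, Real.norm_eq_abs]
    have := sq_pos_of_pos hs0
    simp only [mul_one, sq_abs, mul_zero]
    linarith
  have hy1 : 1 < ‖y‖ := by nlinarith [norm_nonneg y]
  obtain ⟨i, hi⟩ := hex (‖y‖⁻¹ • y) (by
    rw [norm_smul, norm_inv, norm_norm, inv_mul_cancel₀ (by linarith)])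
  rw [real_inner_smul_left, le_inv_mul_iff₀ (by linarith)] at hi
  nlinarith [hs i]

theorem exists_mem_minNormEvent (hcard : k + 2 ≤ Fintype.card ι) (hx₀ : ‖x₀‖ = 1)
    (hle : ∀ i, inner ℝ x₀ (a i : EuclideanSpace ℝ (Fin (k + 2))) ≤ c)
    (hex : ∀ x : EuclideanSpace ℝ (Fin (k + 2)), ‖x‖ = 1 →
      ∃ i, c ≤ inner ℝ x (a i : EuclideanSpace ℝ (Fin (k + 2))))
    (hgp : ∀ K : Finset ι, K.card ≤ k + 2 →
      LinearIndependent ℝ (fun i : K => (a i : EuclideanSpace ℝ (Fin (k + 2)))))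
    {ε : ℝ} (hε : |c| ≤ ε) :
    ∃ K : Finset ι, K.card = k + 2 ∧ (a ∈ minNormEvent K ε 1 ∨ a ∈ minNormEvent K ε (-1)) := by
  classical
  set A : ι → EuclideanSpace ℝ (Fin (k + 2)) := fun i => a i with hA
  have hne : Nonempty ι := Fintype.card_pos_iff.1 (by omega)
  rcases lt_or_ge 0 c with hc | hc
  · have hnorm : ‖c • x₀‖ = c := by rw [norm_smul, hx₀, mul_one, Real.norm_of_nonneg hc.le]
    have hmem := mem_convexHull_of_norm_le (a := A) hex hnorm.le (range_nonempty A)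
    have hp0 : c • x₀ ≠ 0 := by rw [← norm_pos_iff, hnorm]; exact hc
    have hin : ∀ i, inner ℝ (c • x₀) (A i) ≤ ‖c • x₀‖ ^ 2 := fun i => by
      rw [hnorm, real_inner_smul_left]
      nlinarith [hle i]
    obtain ⟨I, w, hw, hw1, hwp, hI, hlin⟩ := exists_linearIndependent_face hmem hp0
      (σ := -1) (by norm_num) (fun i => by linarith [hin i])
    set J : Finset ι := Finset.univ.filter fun i => inner ℝ x₀ (A i) = c with hJ
    have hIJ : I ⊆ J := fun i hi => by
      have h1 := hI i hi
      rw [hnorm, real_inner_smul_left, sq] at h1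
      exact Finset.mem_filter.2 ⟨Finset.mem_univ _, mul_left_cancel₀ hc.ne' h1⟩
    have hJcard := card_active_ge (a := a) hx₀ hle hex hc
      (fun i hi => by simpa [hJ] using hi) hIJ hwp
    have hIcard : I.card ≤ k + 2 := by simpa using hlin.fintype_card_le_finrank
    -- Enlarging `I` within the active set `J` keeps ⟨p, a_i⟩ = ‖p‖² on `K`, so p remains the
    -- least-norm point of the hull of `K`.
    obtain ⟨K, hIK, hKJ, hK⟩ := Finset.exists_subsuperset_card_eq hIJ hIcard hJcard
    refine ⟨K, hK, Or.inl (mem_minNormEvent_of_subset hIK hw hw1 hwp ?_ ?_ ?_)⟩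
    · rw [hnorm]; exact (le_abs_self c).trans hε
    · intro i hi
      have h1 := (Finset.mem_filter.1 (hKJ hi)).2
      rw [real_inner_smul_left, hnorm]
      change c ^ 2 ≤ c * inner ℝ x₀ (A i)
      rw [h1, sq]
    · intro j
      rw [one_mul]
      exact hin j
  · have hconv := convex_convexHull ℝ (range A)
    have hcompact := (finite_range A).isCompact_convexHull ℝ
    -- For c ≤ 0 take the point of the whole hull nearest to the origin.
    obtain ⟨p, hp, hpmin⟩ := exists_norm_eq_iInf_of_complete_convex
      ((range_nonempty A).convexHull (𝕜 := ℝ)) hcompact.isComplete hconv 0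
    have hin0 := (norm_eq_iInf_iff_real_inner_le_zero hconv hp).1 hpmin
    have hin : ∀ i, ‖p‖ ^ 2 ≤ inner ℝ p (A i) := fun i => by
      have := hin0 _ (subset_convexHull ℝ _ (mem_range_self i))
      rw [zero_sub, inner_neg_left, inner_sub_right, real_inner_self_eq_norm_sq] at this
      linarith
    have hp0 : p ≠ 0 := by
      rintro rfl
      exact zero_notMem_convexHull hx₀ (fun i => (hle i).trans hc) hgp hp
    have hpn : 0 < ‖p‖ := norm_pos_iff.2 hp0
    have hpc : ‖p‖ ≤ -c := by
      -- Testing the min-max value in the direction -p bounds ‖p‖ by -c.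
      obtain ⟨i, hi⟩ := hex (-(‖p‖⁻¹ • p)) (by
        rw [norm_neg, norm_smul, norm_inv, norm_norm, inv_mul_cancel₀ hpn.ne'])
      rw [inner_neg_left, real_inner_smul_left] at hi
      have h1 : ‖p‖ ≤ ‖p‖⁻¹ * inner ℝ p (A i) := by
        rw [le_inv_mul_iff₀ hpn, ← sq]
        exact hin i
      linarith
    obtain ⟨I, w, hw, hw1, hwp, -, hlin⟩ := exists_linearIndependent_face hp hp0
      (σ := 1) one_ne_zero (fun i => by linarith [hin i])
    have hIcard : I.card ≤ k + 2 := by simpa using hlin.fintype_card_le_finrank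
    -- Any m-element superset works, because ⟨p, a_i⟩ ≥ ‖p‖² holds for all rows.
    obtain ⟨K, hIK, -, hK⟩ := Finset.exists_subsuperset_card_eq (Finset.subset_univ I) hIcard
      (by simpa using hcard)
    refine ⟨K, hK, Or.inr (mem_minNormEvent_of_subset hIK hw hw1 hwp ?_ (fun i _ => hin i) ?_)⟩
    · exact hpc.trans ((neg_le_abs c).trans hε)
    · intro j
      have := hin j
      have h2 := sq_nonneg ‖p‖
      change -1 * inner ℝ p (A j) ≤ ‖p‖ ^ 2
      linarith

end

/-! ### Cutoff, tail and moments -/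

theorem phi_antitone (m : ℕ) {s t : ℝ} (hst : s ≤ t) : phi m t ≤ phi m s := by
  have hpi := sinInt_pi_pos (m - 2)
  have hc : Real.arccos (Real.exp (-s)) ≤ Real.arccos (Real.exp (-t)) :=
    Real.arccos_le_arccos (Real.exp_le_exp.2 (by linarith))
  have hI : sinInt (m - 2) (Real.arccos (Real.exp (-s))) ≤
      sinInt (m - 2) (Real.arccos (Real.exp (-t))) := by
    rcases hc.eq_or_lt with h | h
    · rw [h]
    · exact (sinInt_lt (m - 2) (Real.arccos_nonneg _) h (Real.arccos_le_pi _)).le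
  have := div_le_div_of_nonneg_right hI hpi.le
  unfold phi
  linarith

/-- For n = 1 the target value would be 1/2, which φ does not attain; n ≥ 2 keeps it inside the
range of φ. -/
theorem cutoff_spec {m n : ℕ} (hn : 2 ≤ n) :
    0 ≤ cutoff m n ∧ phi m (cutoff m n) = (1 / 2 : ℝ) ^ (1 / Real.sqrt n) := by
  have hs : 1 < Real.sqrt n := by
    rw [Real.lt_sqrt (by norm_num)]
    have : (2 : ℝ) ≤ n := by exact_mod_cast hn
    linarith
  have hlt : 1 / Real.sqrt n < 1 := by rw [div_lt_one (by linarith)]; exact hs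
  have hpos : 0 < 1 / Real.sqrt n := by positivity
  have hmem : (1 / 2 : ℝ) ^ (1 / Real.sqrt n) ∈ Ioc (1 / 2 : ℝ) 1 := by
    constructor
    · have := Real.rpow_lt_rpow_of_exponent_gt (x := (1 / 2 : ℝ)) (by norm_num) (by norm_num) hlt
      rwa [Real.rpow_one] at this
    · exact Real.rpow_le_one (by norm_num) (by norm_num) hpos.le
  have hex := (phi_bijOn m).surjOn hmem
  exact ⟨Function.invFunOn_mem hex, Function.invFunOn_eq hex⟩

theorem phi_pow_le {m n : ℕ} (hn : 2 ≤ n) (hmn : m ≤ n) {t : ℝ} (ht : cutoff m n ≤ t) :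
    phi m t ^ (n - m) ≤ (2 : ℝ) ^ (-(((n : ℝ) - m) / Real.sqrt n)) := by
  obtain ⟨h0, h1⟩ := cutoff_spec (m := m) hn
  have hnn : 0 ≤ phi m t := by
    have := ((phi_bijOn m).mapsTo (show t ∈ Ici 0 from h0.trans ht)).1
    linarith
  calc phi m t ^ (n - m) ≤ ((1 / 2 : ℝ) ^ (1 / Real.sqrt n)) ^ (n - m) := by
        rw [← h1]; exact pow_le_pow_left₀ hnn (phi_antitone m ht) _
    _ = _ := by
        rw [← Real.rpow_mul_natCast (by norm_num), one_div (2 : ℝ), Real.inv_rpow (by norm_num),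
          ← Real.rpow_neg (by norm_num), Nat.cast_sub hmn]
        congr 1
        ring

/-- Tail of the condition number. -/
theorem measure_abs_cos_theta_le {k n : ℕ} (hk : 1 ≤ k) (hkn : k + 2 ≤ n) {t : ℝ} (ht : 0 ≤ t) :
    Measure.pi (fun _ : Fin n => uniformSphere (k + 2))
      {a | |Real.cos (theta (matrixOfRows a))| ≤ Real.exp (-t)} ≤
      n.choose (k + 2) * (2 * (ENNReal.ofReal (phi (k + 2) t) ^ (n - (k + 2)) *
        ENNReal.ofReal ((k + 2) * ((k + 2) * Real.exp (-t) * Real.sqrt (k + 2))))) := by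
  set μ := Measure.pi (fun _ : Fin n => uniformSphere (k + 2))
  set b := ENNReal.ofReal (phi (k + 2) t) ^ (n - (k + 2)) *
        ENNReal.ofReal ((k + 2) * ((k + 2) * Real.exp (-t) * Real.sqrt (k + 2)))
  set S : Finset (Finset (Fin n)) := Finset.powersetCard (k + 2) Finset.univ
  have hsub : {a | |Real.cos (theta (matrixOfRows a))| ≤ Real.exp (-t)} ≤ᵐ[μ]
      (⋃ K ∈ S, (minNormEvent K (Real.exp (-t)) 1 ∪ minNormEvent K (Real.exp (-t)) (-1)) :
        Set (Fin n → USphere (k + 2))) := by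
    filter_upwards [ae_forall_linearIndependent (ι := Fin n) hk] with a hgp ha
    obtain ⟨x₀, hx₀, hle, hex⟩ := exists_cos_theta (by omega) a
    obtain ⟨K, hK, h⟩ := exists_mem_minNormEvent (by simpa using hkn) hx₀ hle hex hgp ha
    exact mem_iUnion₂.2 ⟨K, Finset.mem_powersetCard.2 ⟨Finset.subset_univ _, hK⟩, h⟩
  calc _ ≤ μ (⋃ K ∈ S, (minNormEvent K (Real.exp (-t)) 1 ∪
        minNormEvent K (Real.exp (-t)) (-1))) := measure_mono_ae hsub
    _ ≤ ∑ K ∈ S, μ (minNormEvent K (Real.exp (-t)) 1 ∪ minNormEvent K (Real.exp (-t)) (-1)) :=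
        measure_biUnion_finset_le _ _
    _ ≤ ∑ K ∈ S, 2 * b := by
        refine Finset.sum_le_sum fun K hK => ?_
        have hKc := (Finset.mem_powersetCard.1 hK).2
        have h1 := measure_minNormEvent_le (σ := 1) hk hKc ht (by simp)
        have h2 := measure_minNormEvent_le (σ := -1) hk hKc ht (by simp)
        rw [Fintype.card_fin] at h1 h2
        rw [two_mul]
        exact (measure_union_le _ _).trans (add_le_add h1 h2)
    _ = _ := by
        rw [Finset.sum_const, Finset.card_powersetCard, Finset.card_univ, Fintype.card_fin,
          nsmul_eq_mul]

/-- Tail of the condition number beyond the cutoff. -/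
theorem measure_abs_cos_theta_le_exp {m n : ℕ} (hm : 3 ≤ m) (hmn : m ≤ n) {t : ℝ}
    (ht : cutoff m n ≤ t) :
    Measure.pi (fun _ : Fin n => uniformSphere m)
      {a | |Real.cos (theta (matrixOfRows a))| ≤ Real.exp (-t)} ≤
      ENNReal.ofReal ((n.choose m : ℝ) * (2 * (m : ℝ) ^ (5 / 2 : ℝ)) *
            (2 : ℝ) ^ (-(((n : ℝ) - (m : ℝ)) / Real.sqrt n)) * Real.exp (-t)) := by
  obtain ⟨k, rfl⟩ : ∃ k, m = k + 2 := ⟨m - 2, by omega⟩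
  have h0 := (cutoff_spec (m := k + 2) (n := n) (by omega)).1.trans ht
  refine (measure_abs_cos_theta_le (by omega) hmn h0).trans ?_
  have hφ : 0 ≤ phi (k + 2) t := by
    have := ((phi_bijOn (k + 2)).mapsTo (show t ∈ Ici 0 from h0)).1
    linarith
  rw [← ENNReal.ofReal_pow hφ, ← ENNReal.ofReal_mul (by positivity),
    ← ENNReal.ofReal_ofNat 2, ← ENNReal.ofReal_mul (by positivity), ← ENNReal.ofReal_natCast,
    ← ENNReal.ofReal_mul (by positivity)]
  refine ENNReal.ofReal_le_ofReal ?_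
  have hp := phi_pow_le (by omega) hmn ht
  have hpow : ((k + 2 : ℕ) : ℝ) ^ (5 / 2 : ℝ) = (k + 2) * ((k + 2) * Real.sqrt (k + 2)) := by
    have hpos : (0 : ℝ) < k + 2 := by positivity
    rw [show (5 / 2 : ℝ) = 1 + (1 + 1 / 2) by norm_num, Nat.cast_add, Nat.cast_ofNat,
      Real.rpow_add hpos, Real.rpow_add hpos, Real.rpow_one, Real.sqrt_eq_rpow]
  rw [hpow]
  calc _ = (n.choose (k + 2) : ℝ) * (2 * ((k + 2) * ((k + 2) * Real.sqrt (k + 2)))) *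
        phi (k + 2) t ^ (n - (k + 2)) * Real.exp (-t) := by ring
    _ ≤ _ := by gcongr

/-- Moments of a random variable with an exponential tail beyond `f`. -/
theorem lintegral_rpow_le_of_exp_tail {Ω : Type*} [MeasurableSpace Ω] (P : Measure Ω)
    [IsProbabilityMeasure P] {X : Ω → ℝ≥0∞} (hX : Measurable X) {f C γ : ℝ} (hf : 0 ≤ f)
    (hC : 0 ≤ C) (hγ : 0 ≤ γ)
    (htail : ∀ t, f ≤ t → P {ω | ENNReal.ofReal t < X ω} ≤ ENNReal.ofReal (C * Real.exp (-t))) :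
    ∫⁻ ω, X ω ^ γ ∂P ≤ ENNReal.ofReal (f ^ γ + C * Real.Gamma (γ + 1)) := by
  -- The layer-cake formula needs γ > 0; for γ = 0 the integrand is 1, also where X is 0 or ∞.
  rcases hγ.eq_or_lt with rfl | hγ
  · simp only [ENNReal.rpow_zero, lintegral_const, measure_univ, mul_one, Real.rpow_zero, zero_add,
      Real.Gamma_one]
    rw [ENNReal.one_le_ofReal]
    linarith
  have htop : ∀ᵐ ω ∂P, X ω ≠ ⊤ := by
    have h1 : ∀ t, f ≤ t → P {ω | X ω = ⊤} ≤ ENNReal.ofReal (C * Real.exp (-t)) := fun t ht =>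
      (measure_mono fun ω (hω : X ω = ⊤) =>
        show ENNReal.ofReal t < X ω from hω ▸ ENNReal.ofReal_lt_top).trans (htail t ht)
    have h2 : Filter.Tendsto (fun t : ℝ => ENNReal.ofReal (C * Real.exp (-t))) Filter.atTop
        (nhds 0) := by
      have := (Real.tendsto_exp_neg_atTop_nhds_zero.const_mul C)
      rw [mul_zero] at this
      simpa using ENNReal.tendsto_ofReal this
    have h3 : P {ω | X ω = ⊤} ≤ 0 :=
      ge_of_tendsto h2 ((Filter.eventually_ge_atTop f).mono h1)
    rw [ae_iff]
    simpa using h3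
  have hY : ∫⁻ ω, X ω ^ γ ∂P = ∫⁻ ω, ENNReal.ofReal ((X ω).toReal ^ γ) ∂P := by
    refine lintegral_congr_ae ?_
    filter_upwards [htop] with ω hω
    rw [← ENNReal.ofReal_rpow_of_nonneg ENNReal.toReal_nonneg hγ.le, ENNReal.ofReal_toReal hω]
  rw [hY, lintegral_rpow_eq_lintegral_meas_lt_mul P (ae_of_all _ fun ω => ENNReal.toReal_nonneg)
    hX.ennreal_toReal.aemeasurable hγ]
  -- Up to f the probability is bounded by 1, which contributes f^γ. Beyond f the exponential tail
  -- is used, and its integral is enlarged to (0, ∞) to produce Γ(γ).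
  have hbound : ∀ t ∈ Ioi (0 : ℝ), P {ω | t < (X ω).toReal} * ENNReal.ofReal (t ^ (γ - 1)) ≤
      (Ioc 0 f).indicator (fun t => ENNReal.ofReal (t ^ (γ - 1))) t +
        ENNReal.ofReal (C * (Real.exp (-t) * t ^ (γ - 1))) := by
    intro t ht
    rcases le_or_gt t f with h | h
    · rw [indicator_of_mem (show t ∈ Ioc 0 f from ⟨ht, h⟩)]
      calc _ ≤ 1 * ENNReal.ofReal (t ^ (γ - 1)) := mul_le_mul_left prob_le_one _
        _ ≤ _ := by rw [one_mul]; exact le_self_add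
    · refine le_trans ?_ le_add_self
      rw [← mul_assoc, ENNReal.ofReal_mul (by positivity)]
      refine mul_le_mul_left ((measure_mono fun ω (hω : t < (X ω).toReal) => ?_).trans
        (htail t h.le)) _
      show ENNReal.ofReal t < X ω
      exact (ENNReal.ofReal_lt_iff_lt_toReal (le_of_lt ht)
        (fun htop => by simp [htop] at hω; exact absurd ht (not_lt.2 hω.le))).2 hω
  have hI1 : ∫⁻ t in Ioi (0 : ℝ), (Ioc 0 f).indicator (fun t => ENNReal.ofReal (t ^ (γ - 1))) t =
      ENNReal.ofReal (f ^ γ / γ) := by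
    rw [setLIntegral_indicator measurableSet_Ioc, inter_eq_left.2 Ioc_subset_Ioi_self]
    have hint : IntervalIntegrable (fun t : ℝ => t ^ (γ - 1)) volume 0 f :=
      intervalIntegral.intervalIntegrable_rpow' (by linarith)
    rw [← ofReal_integral_eq_lintegral_ofReal hint.1, ← intervalIntegral.integral_of_le hf,
      integral_rpow (Or.inl (by linarith))]
    · rw [sub_add_cancel, Real.zero_rpow hγ.ne', sub_zero]
    · filter_upwards [ae_restrict_mem measurableSet_Ioc] with t ht
      exact Real.rpow_nonneg ht.1.le _
  have hI2 : ∫⁻ t in Ioi (0 : ℝ), ENNReal.ofReal (C * (Real.exp (-t) * t ^ (γ - 1))) =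
      ENNReal.ofReal (C * Real.Gamma γ) := by
    rw [← ofReal_integral_eq_lintegral_ofReal, integral_const_mul, Real.Gamma_eq_integral hγ]
    · exact (Real.GammaIntegral_convergent hγ).const_mul C
    · filter_upwards [ae_restrict_mem measurableSet_Ioi] with t ht
      have := Real.rpow_nonneg (le_of_lt ht) (γ - 1)
      simp only [Pi.zero_apply]
      positivity
  calc _ ≤ ENNReal.ofReal γ * ∫⁻ t in Ioi (0 : ℝ),
        ((Ioc 0 f).indicator (fun t => ENNReal.ofReal (t ^ (γ - 1))) t +
        ENNReal.ofReal (C * (Real.exp (-t) * t ^ (γ - 1)))) :=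
        mul_le_mul_right (setLIntegral_mono' measurableSet_Ioi hbound) _
    _ = ENNReal.ofReal γ * (ENNReal.ofReal (f ^ γ / γ) + ENNReal.ofReal (C * Real.Gamma γ)) := by
        rw [lintegral_add_right _ (by fun_prop), hI1, hI2]
    _ = _ := by
        have hG := Real.Gamma_pos_of_pos hγ
        rw [← ENNReal.ofReal_add (by positivity) (by positivity), ← ENNReal.ofReal_mul hγ.le,
          Real.Gamma_add_one hγ.ne']
        congr 1
        field_simp

/-- If |cos θ| > e^{-t}, the cosine is nonzero, so the logarithm is the real number -log |cos θ| <
t. The value cos θ = 0 satisfies the conclusion trivially. -/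
theorem abs_cos_theta_le_of_lt_logCondNumber {n m : ℕ} {A : Matrix (Fin n) (Fin m) ℝ} {t : ℝ}
    (h : ENNReal.ofReal t < logCondNumber A) : |Real.cos (theta A)| ≤ Real.exp (-t) := by
  by_contra! hlt
  refine absurd h (not_lt.2 ?_)
  have hpos := (Real.exp_pos (-t)).trans hlt
  unfold logCondNumber condNumber
  rw [ENNReal.log_inv, ENNReal.log_ofReal_of_pos hpos, ← EReal.coe_neg,
    EReal.toENNReal_of_ne_top (EReal.coe_ne_top _), EReal.toReal_coe]
  refine ENNReal.ofReal_le_ofReal ?_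
  have := (Real.lt_log_iff_exp_lt hpos).2 hlt
  linarith

end ConicCond

end

theorem mainTheorem11 {Ω : Type*} [MeasurableSpace Ω] (P : Measure Ω) [IsProbabilityMeasure P]
    (n m : ℕ) (hm : 3 ≤ m) (hmn : m ≤ n)
    (A : Fin n → Ω → ConicCond.USphere m) (hA : ConicCond.IsUniformRandomRows P A)
    (γ : ℝ) (hγ : 0 ≤ γ) :
    Measurable (fun ω => ConicCond.condNumber (ConicCond.matrixOfRows fun i => A i ω)) ∧
    ∫⁻ ω, ConicCond.logCondNumber (ConicCond.matrixOfRows fun i => A i ω) ^ γ ∂P ≤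
      ENNReal.ofReal
        (ConicCond.cutoff m n ^ γ +
          (n.choose m : ℝ) * (2 * (m : ℝ) ^ (5 / 2 : ℝ)) *
            (2 : ℝ) ^ (-(((n : ℝ) - (m : ℝ)) / Real.sqrt n)) * Real.Gamma (γ + 1)) := by
  have hcos := ConicCond.measurable_cos_theta (n := n) (m := m) (by omega)
  have hAm : Measurable fun ω i => A i ω := measurable_pi_lambda _ hA.measurable
  have habs : Measurable fun ω =>
      |Real.cos (ConicCond.theta (ConicCond.matrixOfRows fun i => A i ω))| :=
    continuous_abs.measurable.comp (hcos.comp hAm)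
  have hcond : Measurable
      (fun ω => ConicCond.condNumber (ConicCond.matrixOfRows fun i => A i ω)) :=
    (ENNReal.measurable_ofReal.comp habs).inv
  -- Independence turns the joint law into a product measure, on which the tail bound was proved.
  have hlaw : P.map (fun ω i => A i ω) =
      Measure.pi fun _ : Fin n => ConicCond.uniformSphere m := by
    rw [(iIndepFun_iff_map_fun_eq_pi_map fun i => (hA.measurable i).aemeasurable).1 hA.indep]
    simp_rw [hA.law]
  refine ⟨hcond, ConicCond.lintegral_rpow_le_of_exp_tail P
    (ENNReal.measurable_log.comp hcond).ereal_toENNReal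
    (ConicCond.cutoff_spec (by omega)).1 (by positivity) hγ fun t ht => ?_⟩
  refine le_trans ?_ (ConicCond.measure_abs_cos_theta_le_exp hm hmn ht)
  rw [← hlaw, Measure.map_apply hAm]
  · exact measure_mono fun ω hω => ConicCond.abs_cos_theta_le_of_lt_logCondNumber hω
  · exact measurableSet_le (continuous_abs.measurable.comp hcos) measurable_const
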